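/- **Hurwitz action.** For a group $\Gamma$ and $g\in\Gamma$, a $g$-factorization of length $r$ is a vector $(f_1,\dots,f_r)\in\Gamma^r$ with $f_1\cdots f_r=g$. Let $B_r=\langle\sigma_1,\dots,\sigma_{r-1}\mid \sigma_i\sigma_{i+1}\sigma_i=\sigma_{i+1}\sigma_i\sigma_{i+1},\ \sigma_i\sigma_j=\sigma_j\sigma_i\ (|i-j|\ge 2)\rangle$ be the braid group. It acts on the right on the set of $g$-factorizations of length $r$ by $$(f_1,\dots,f_r)\sigma_i=(f_1,\dots,f_{i-1},\,f_{i+1},\,f_{i+1}^{-1}f_if_{i+1},\,f_{i+2},\dots,f_r).$$ Two factorizations are Hurwitz equivalent, written $\cong_H$, if they lie in the same orbit. A homomorphism is applied to a factorization entry by entry. **Choices.** Write $F_k$ for the free group of rank $k$. An element $A$ of a group has a root if $A=w^k$ for some element $w$ and some integer $k\ne\pm1$. Fix the following. 1. For all $r_1,r_2\ge 0$, an injective homomorphism $i_{(r_1,r_2)}:F_{r_1}\oplus F_{r_2}\to F_2\oplus F_2$. 2. For every $k\ge2$ and every tuple $V=(v_1,\dots,v_m)$ of words in $z_1^{\pm1},\dots,z_k^{\pm1}$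 that are not all trivial in the free group $F_k$ on $z_1,\dots,z_k$, a word $H_V$ that represents an element of the normal closure of $\{v_1,\dots,v_m\}$ in $F_k$ and has no root in $F_k$. 3. For every $n\ge5$, an injective homomorphism $ib_n:F_2\oplus F_2\to B_n$. **Construction.** Let $G=\langle z_1,\dots,z_k\mid v_1,\dots,v_m\rangle$ be a finite presentation with $k\ge2$ generators in which at least one relator $v_j$ is non-trivial in $F_k$; let $V=(v_1,\dots,v_m)$, let $a$ be a word in $z_1^{\pm1},\dots,z_k^{\pm1}$, and put $h=a^{-1}H_Va$. Let $F_{k+1}$ be free on $X_1,\dots,X_{k+1}$. Let $P(G,a)$ be the $1$-factorization of $F_k\oplus F_{k+1}$ of length $m+k+4$ with the entries, in this order, $$(v_1,1),\dots,(v_m,1),\ ((v_1\cdots v_m)^{-1},1),\ (z_1,X_1),\dots,(z_k,X_k),$$ $$((z_1\cdots z_k)^{-1},(X_1\cdots X_k)^{-1}),\ (h^{-1},X_{k+1}^{-1}),\ (h,X_{k+1}).$$ Define $FTL_B(G,a)=i_{(k,k+1)}(P(G,a))$, a $1$-factorization of $F_2\oplus F_2$, and, for $n\ge5$, $FTL_n(G,a)=ib_n(FTL_B(G,a))$,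 a $1$-factorization of $B_n$. **Statement.** Choices as in 1, 2 and 3 exist. For any such choices, every $n\ge5$, every presentation $G$ as above, and all words $a,b$ in its generators and their inverses, $$a=_G b\quad\Longleftrightarrow\quad FTL_n(G,a)\cong_H FTL_n(G,b).$$ -/

import Mathlib

open scoped RightActions

/-! ## The braid group -/

/-- The defining relators of the braid group on `n` strands, with generators
`σ_i` indexed by `i : Fin (n - 1)`. -/
def braidRels (n : ℕ) : Set (FreeGroup (Fin (n - 1))) :=
  {w | ∃ i j : Fin (n - 1), (i : ℕ) + 1 = j ∧
    w = (FreeGroup.of i * FreeGroup.of j * FreeGroup.of i) *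
      (FreeGroup.of j * FreeGroup.of i * FreeGroup.of j)⁻¹} ∪
  {w | ∃ i j : Fin (n - 1), (i : ℕ) + 2 ≤ j ∧
    w = (FreeGroup.of i * FreeGroup.of j) * (FreeGroup.of j * FreeGroup.of i)⁻¹}

/-- The braid group `B_n`, by its standard presentation. -/
abbrev BraidGroup (n : ℕ) : Type := PresentedGroup (braidRels n)

/-! ## Factorizations and the Hurwitz braid action -/

/-- `g`-factorizations of length `r`: vectors `(f_1, …, f_r) ∈ G^r` whose (ordered) product
is `g`. -/
def Factorization {G : Type*} [Group G] (g : G) (r : ℕ) : Type _ :=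
  {F : Fin r → G // (List.ofFn F).prod = g}

section HurwitzAction

variable {G : Type*} [Group G]

/-- `(…, f_i, f_{i+1}, …) ↦ (…, f_{i+1}, f_{i+1}⁻¹ f_i f_{i+1}, …)`. -/
def hurwitzMove {r : ℕ} (i : Fin (r - 1)) (F : Fin r → G) : Fin r → G := fun k =>
  if (k : ℕ) = i then F ⟨i + 1, by omega⟩
  else if (k : ℕ) = i + 1 then
    (F ⟨i + 1, by omega⟩)⁻¹ * F ⟨i, by omega⟩ * F ⟨i + 1, by omega⟩
  else F k

/-- `(…, f_i, f_{i+1}, …) ↦ (…, f_i f_{i+1} f_i⁻¹, f_i, …)`. -/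
def hurwitzMoveInv {r : ℕ} (i : Fin (r - 1)) (F : Fin r → G) : Fin r → G := fun k =>
  if (k : ℕ) = i then
    F ⟨i, by omega⟩ * F ⟨i + 1, by omega⟩ * (F ⟨i, by omega⟩)⁻¹
  else if (k : ℕ) = i + 1 then F ⟨i, by omega⟩
  else F k

theorem hurwitzMoveInv_hurwitzMove {r : ℕ} (i : Fin (r - 1)) (F : Fin r → G) :
    hurwitzMoveInv i (hurwitzMove i F) = F := by
  funext k
  obtain ⟨k, hk⟩ := k
  simp only [hurwitzMoveInv, hurwitzMove]
  split_ifs <;> first | omega | (subst_vars; simp [mul_assoc])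

theorem hurwitzMove_hurwitzMoveInv {r : ℕ} (i : Fin (r - 1)) (F : Fin r → G) :
    hurwitzMove i (hurwitzMoveInv i F) = F := by
  funext k
  obtain ⟨k, hk⟩ := k
  simp only [hurwitzMoveInv, hurwitzMove]
  split_ifs <;> first | omega | (subst_vars; simp [mul_assoc])

theorem partialProd_hurwitzMove {r : ℕ} (i : Fin (r - 1)) (F : Fin r → G) (k : ℕ)
    (hk : k < r + 1) :
    Fin.partialProd (hurwitzMove i F) ⟨k, hk⟩ =
      if k = i + 1 then Fin.partialProd F ⟨i, by omega⟩ * F ⟨i + 1, by omega⟩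
      else Fin.partialProd F ⟨k, hk⟩ := by
  have step : ∀ (E : Fin r → G) (k : ℕ) (hk : k < r),
      Fin.partialProd E ⟨k + 1, by omega⟩ = Fin.partialProd E ⟨k, by omega⟩ * E ⟨k, hk⟩ :=
    fun E k hk => Fin.partialProd_succ E ⟨k, hk⟩
  revert hk
  induction k with
  | zero =>
    intro hk
    rw [if_neg (by omega)]
    exact (Fin.partialProd_zero _).trans (Fin.partialProd_zero _).symm
  | succ k ih =>
    intro hk
    rw [step _ k (by omega), ih (by omega)]
    by_cases h1 : k = i
    · subst h1
      simp [hurwitzMove]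
    · by_cases h2 : k = i + 1
      · subst h2
        rw [if_pos rfl, if_neg (by omega), step F _ (by omega), step F _ (by omega)]
        simp [hurwitzMove, mul_assoc]
      · rw [if_neg h2, if_neg (by omega), step F k (by omega)]
        simp [hurwitzMove, h1, h2]

theorem prod_hurwitzMove {r : ℕ} (i : Fin (r - 1)) (F : Fin r → G) :
    (List.ofFn (hurwitzMove i F)).prod = (List.ofFn F).prod := by
  have key : ∀ E : Fin r → G, (List.ofFn E).prod = Fin.partialProd E ⟨r, by omega⟩ := by
    intro E
    simp [Fin.partialProd, List.take_of_length_le]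
  rw [key, key, partialProd_hurwitzMove, if_neg (by omega)]

/-- The permutation of the set of `g`-factorizations of length `r` given by `σ_i`. -/
def hurwitzPerm (g : G) {r : ℕ} (i : Fin (r - 1)) : Equiv.Perm (Factorization g r) where
  toFun F := ⟨hurwitzMove i F.1, (prod_hurwitzMove i F.1).trans F.2⟩
  invFun F := ⟨hurwitzMoveInv i F.1, by
    rw [← prod_hurwitzMove i, hurwitzMove_hurwitzMoveInv]
    exact F.2⟩
  left_inv F := Subtype.ext (hurwitzMoveInv_hurwitzMove i F.1)
  right_inv F := Subtype.ext (hurwitzMove_hurwitzMoveInv i F.1)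

theorem hurwitzPerm_apply (g : G) {r : ℕ} (i : Fin (r - 1)) (F : Factorization g r) :
    (hurwitzPerm g i F).1 = hurwitzMove i F.1 := rfl

theorem hurwitzPerm_comm (g : G) {r : ℕ} (i j : Fin (r - 1)) (h : (i : ℕ) + 2 ≤ j) :
    hurwitzPerm g j * hurwitzPerm g i = hurwitzPerm g i * hurwitzPerm g j := by
  apply Equiv.ext
  intro F
  apply Subtype.ext
  funext k
  obtain ⟨k, hk⟩ := k
  simp only [Equiv.Perm.mul_apply, hurwitzPerm_apply, hurwitzMove]
  split_ifs <;> first | omega | rfl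

theorem hurwitzPerm_braid (g : G) {r : ℕ} (i j : Fin (r - 1)) (h : (i : ℕ) + 1 = j) :
    hurwitzPerm g i * (hurwitzPerm g j * hurwitzPerm g i) =
      hurwitzPerm g j * (hurwitzPerm g i * hurwitzPerm g j) := by
  apply Equiv.ext
  intro F
  apply Subtype.ext
  funext k
  obtain ⟨k, hk⟩ := k
  obtain ⟨j, hj⟩ := j
  simp only at h
  subst h
  simp only [Equiv.Perm.mul_apply, hurwitzPerm_apply, hurwitzMove]
  split_ifs <;> first | omega | (simp [mul_assoc])

/-- The Hurwitz braid action as a homomorphism to the opposite of the permutation group,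
i.e. as a right action. -/
def hurwitzHom (g : G) (r : ℕ) : BraidGroup r →* (Equiv.Perm (Factorization g r))ᵐᵒᵖ :=
  PresentedGroup.toGroup (rels := braidRels r)
    (f := fun i => MulOpposite.op (hurwitzPerm g i)) (by
      rintro w (⟨i, j, h, rfl⟩ | ⟨i, j, h, rfl⟩)
      · simp only [map_mul, map_inv, FreeGroup.lift_apply_of, ← MulOpposite.op_mul]
        rw [mul_inv_eq_one, hurwitzPerm_braid g i j h]
      · simp only [map_mul, map_inv, FreeGroup.lift_apply_of, ← MulOpposite.op_mul]
        rw [mul_inv_eq_one, hurwitzPerm_comm g i j h])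

/-- The Hurwitz braid action: the right action of `B_r` on the `g`-factorizations of
length `r` under which `σ_i` acts by `hurwitzMove i`. It is written `F <• b`. -/
instance hurwitzAction (g : G) (r : ℕ) :
    MulAction (BraidGroup r)ᵐᵒᵖ (Factorization g r) where
  smul b F := (hurwitzHom g r b.unop).unop F
  one_smul F := by
    change (hurwitzHom g r 1).unop F = F
    rw [map_one]
    rfl
  mul_smul b c F := by
    change (hurwitzHom g r (c.unop * b.unop)).unop F = _
    rw [map_mul]
    rfl

theorem hurwitzAction_of (g : G) {r : ℕ} (i : Fin (r - 1)) (F : Factorization g r) :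
    (F <• (PresentedGroup.of i : BraidGroup r)).1 = hurwitzMove i F.1 := by
  change ((hurwitzHom g r (PresentedGroup.of i)).unop F).1 = _
  rw [hurwitzHom, PresentedGroup.toGroup.of]
  rfl

/-- Two factorizations are Hurwitz equivalent if they lie in the same orbit of the Hurwitz
braid action. -/
def HurwitzEquiv {g : G} {r : ℕ} (F K : Factorization g r) : Prop :=
  K ∈ MulAction.orbit (BraidGroup r)ᵐᵒᵖ F

/-- The image of a `1`-factorization under a group homomorphism. -/
def Factorization.map {G' : Type*} [Group G'] (f : G →* G') {r : ℕ}
    (F : Factorization (1 : G) r) : Factorization (1 : G') r :=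
  ⟨fun k => f (F.1 k), by
    have h : List.ofFn (fun k => f (F.1 k)) = (List.ofFn F.1).map f := by
      rw [List.map_ofFn]
      rfl
    rw [h, ← map_list_prod, F.2, map_one]⟩

end HurwitzAction

/-! ## The factorization `P_X(R, W, H)` -/

section PX

variable {G₁ G₂ : Type*} [Group G₁] [Group G₂]

/-- `P_X(R, W, H) = ((R_1, 1), …, (R_n, 1), (W_1, X_1), …, (W_m, X_m), (H⁻¹, X_{m+1}),
(H, X_{m+2}))`. -/
def PX {n m : ℕ} (X : Fin (m + 2) → G₂) (R : Fin n → G₁) (W : Fin m → G₁) (H : G₁) :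
    Fin (n + (m + 2)) → G₁ × G₂ :=
  Fin.append (fun i => (R i, 1)) (fun j => (Fin.append W ![H⁻¹, H] j, X j))

/-- `(g_1, …, g_k) ↦ (g_1, …, g_k, (g_1 ⋯ g_k)⁻¹)`. -/
def closeUp {G : Type*} [Group G] {k : ℕ} (g : Fin k → G) : Fin (k + 1) → G :=
  Fin.snoc g (List.ofFn g).prod⁻¹

theorem prod_ofFn_append {G : Type*} [Group G] {k l : ℕ} (g : Fin k → G) (h : Fin l → G) :
    (List.ofFn (Fin.append g h)).prod = (List.ofFn g).prod * (List.ofFn h).prod := by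
  rw [List.ofFn_fin_append, List.prod_append]

theorem prod_closeUp {G : Type*} [Group G] {k : ℕ} (g : Fin k → G) :
    (List.ofFn (closeUp g)).prod = 1 := by
  rw [closeUp, List.ofFn_succ']
  simp

theorem prod_PX {n m : ℕ} (X : Fin (m + 2) → G₂) (R : Fin n → G₁) (W : Fin m → G₁) (H : G₁)
    (hX : (List.ofFn X).prod = 1) (hR : (List.ofFn R).prod = 1)
    (hW : (List.ofFn W).prod = 1) : (List.ofFn (PX X R W H)).prod = 1 := by
  have h1 : ∀ {k : ℕ} (a : Fin k → G₁) (b : Fin k → G₂),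
      (List.ofFn fun j => (a j, b j)).prod = ((List.ofFn a).prod, (List.ofFn b).prod) := by
    intro k a b
    induction k with
    | zero => simp [Prod.ext_iff]
    | succ k ih => simp [List.ofFn_succ, ih (fun j => a j.succ) (fun j => b j.succ)]
  rw [PX, prod_ofFn_append, h1 R (fun _ => 1), h1, prod_ofFn_append, hX, hR, hW]
  ext <;> simp

end PX

/-! ## The functions `FTL` -/

/-- Words in `n` letters and their formal inverses: `(i, true)` stands for the `i`-th
letter, `(i, false)` for its inverse. -/
abbrev GWord (n : ℕ) : Type := List (Fin n × Bool)

/-- An element `A` of a group has a root if `A = w ^ k` for some `w` and some integer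
`k ≠ ±1`. -/
def HasRoot {G : Type*} [Group G] (A : G) : Prop :=
  ∃ (w : G) (k : ℤ), k ≠ 1 ∧ k ≠ -1 ∧ A = w ^ k

/-- `F_2 ⊕ F_2`. -/
abbrev F2F2 : Type := FreeGroup (Fin 2) × FreeGroup (Fin 2)

/-- The elements of the free group represented by the words `v_1, …, v_m`. -/
def evalWords {n m : ℕ} (V : Fin m → GWord n) : Fin m → FreeGroup (Fin n) :=
  fun j => FreeGroup.mk (V j)

/-- The auxiliary choices on which the construction depends: injections
`F_{r₁} ⊕ F_{r₂} → F_2 ⊕ F_2`; for all words `v_1, …, v_m` in `n ≥ 2` letters that are not all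
trivial in the free group, a word `H` without root in the normal closure of `v_1, …, v_m`; and,
for `n ≥ 5`, an injection `F_2 ⊕ F_2 → B_n`. -/
structure FTLChoices where
  inj (r₁ r₂ : ℕ) : FreeGroup (Fin r₁) × FreeGroup (Fin r₂) →* F2F2
  inj_injective (r₁ r₂ : ℕ) : Function.Injective (inj r₁ r₂)
  rootless {n m : ℕ} (V : Fin m → GWord n) : GWord n
  rootless_mem {n m : ℕ} (V : Fin m → GWord n) (hn : 2 ≤ n) (hV : ∃ j, evalWords V j ≠ 1) :
    FreeGroup.mk (rootless V) ∈ Subgroup.normalClosure (Set.range (evalWords V))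
  rootless_not_hasRoot {n m : ℕ} (V : Fin m → GWord n) (hn : 2 ≤ n)
    (hV : ∃ j, evalWords V j ≠ 1) : ¬ HasRoot (FreeGroup.mk (rootless V))
  braidInj (n : ℕ) (hn : 5 ≤ n) : F2F2 →* BraidGroup n
  braidInj_injective (n : ℕ) (hn : 5 ≤ n) : Function.Injective (braidInj n hn)

/-- The factorization `X = (X_1, …, X_n, (X_1 ⋯ X_n)⁻¹, X_{n+1}⁻¹, X_{n+1})` of the free group
on `X_1, …, X_{n+1}`. -/
def FTLX (n : ℕ) : Fin (n + 1 + 2) → FreeGroup (Fin (n + 1)) :=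
  Fin.append (closeUp fun i : Fin n => FreeGroup.of i.castSucc)
    ![(FreeGroup.of (Fin.last n))⁻¹, FreeGroup.of (Fin.last n)]

/-- `P_X(Vf, W, a)` with `Vf = (v_1, …, v_m, (v_1 ⋯ v_m)⁻¹)` and
`W = (z_1, …, z_n, (z_1 ⋯ z_n)⁻¹)`, as a `1`-factorization of `F_n ⊕ F_{n+1}`. -/
def FTLP {n m : ℕ} (V : Fin m → GWord n) (a : GWord n) :
    Factorization (1 : FreeGroup (Fin n) × FreeGroup (Fin (n + 1))) (m + 1 + (n + 1 + 2)) :=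
  ⟨PX (FTLX n) (closeUp (evalWords V)) (closeUp fun i : Fin n => FreeGroup.of i)
      (FreeGroup.mk a),
    prod_PX _ _ _ _ (by rw [FTLX, prod_ofFn_append, prod_closeUp]; simp)
      (prod_closeUp _) (prod_closeUp _)⟩

/-- `FTL_{s1}(F_n, V_m, a) = i_{(n,n+1)} P_X(Vf, W, a)`. -/
def FTLs1 (c : FTLChoices) {n m : ℕ} (V : Fin m → GWord n) (a : GWord n) :
    Factorization (1 : F2F2) (m + 1 + (n + 1 + 2)) :=
  (FTLP V a).map (c.inj n (n + 1))

/-- `FTL_{s2}(F_n, V_m, a) = FTL_{s1}(F_n, V_m, H^a)`, where `H^a` is the word `a⁻¹ H a`. -/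
def FTLs2 (c : FTLChoices) {n m : ℕ} (V : Fin m → GWord n) (a : GWord n) :
    Factorization (1 : F2F2) (m + 1 + (n + 1 + 2)) :=
  FTLs1 c V (FreeGroup.invRev a ++ c.rootless V ++ a)

/-- Finite presentations `⟨W_1, …, W_n ∣ R_1, …, R_m⟩` with at least two generators and at
least one relator that is non-trivial in the free group. -/
structure GSPresentation where
  numGens : ℕ
  numRels : ℕ
  rel : Fin numRels → GWord numGens
  two_le_numGens : 2 ≤ numGens
  exists_rel_ne_one : ∃ j, evalWords rel j ≠ 1

/-- The group presented by `P`. -/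
abbrev GSPresentation.Grp (P : GSPresentation) : Type :=
  PresentedGroup (Set.range (evalWords P.rel))

/-- The element of the group presented by `P` that a word represents. -/
def GSPresentation.eval (P : GSPresentation) (a : GWord P.numGens) : P.Grp :=
  PresentedGroup.mk _ (FreeGroup.mk a)

/-- `FTL_B(G, a)`, a `1`-factorization of `F_2 ⊕ F_2`. -/
def FTLB (c : FTLChoices) (P : GSPresentation) (a : GWord P.numGens) :
    Factorization (1 : F2F2) (P.numRels + 1 + (P.numGens + 1 + 2)) :=
  FTLs2 c P.rel a

/-- `FTL_n(G, a)`, a `1`-factorization of the braid group `B_n`, `n ≥ 5`. -/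
def FTLn (c : FTLChoices) (n : ℕ) (hn : 5 ≤ n) (P : GSPresentation) (a : GWord P.numGens) :
    Factorization (1 : BraidGroup n) (P.numRels + 1 + (P.numGens + 1 + 2)) :=
  (FTLB c P a).map (c.braidInj n hn)

/-!
The proof has two halves.

*The equivalence.* Injective homomorphisms preserve and reflect Hurwitz equivalence
(`hurwitzEquiv_map_iff`), so everything happens in `F_k × F_{k+1}`. The last two entries of the
factorization are a pair `c⁻¹, c` with `c = (h, X_{k+1})`. Its product is trivial, so it can be moved
past an entry without any change; if instead the entry is moved past the pair, the pair is
conjugated by it. Hence it can be conjugated by the whole subgroup that the other entries generate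
(`eqvGen_pair_conj_of_mem_closure`). This subgroup contains `(x, 1)` for every `x` in the normal
closure `N` of the relators, since the entries `(z_i, X_i)` conjugate `(v_j, 1)` by arbitrary words
in the first factor. So `h` may be replaced by `x⁻¹ h x` for `x ∈ N`.

Conversely, Hurwitz moves only permute the entries and conjugate them by elements of the subgroup
generated by all entries (`HurwitzEquiv.exists_conj`). Exponent sums in the second factor show that
the last entry `(h', X_{k+1})` can only be a conjugate of `(h, X_{k+1})`, say by `(x, y)`. Then `y`
centralizes `X_{k+1}`, so it is a power of it. The two coordinates of an element of the subgroup
agree in the presented group once `X_i` is sent to `z_i` and `X_{k+1}` to `1`, so `x ∈ N`. With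
`h = a⁻¹ H a` and `h' = b⁻¹ H b` it follows that `a x b⁻¹` centralizes `H`; as `H` has no root,
it is a power of `H`, which lies in `N`. Centralizers are controlled by the Nielsen–Schreier theorem:
two commuting elements of a free group lie in a common cyclic subgroup.

*Existence of the choices.* The free group of rank `r` embeds in that of rank two by
`x_i ↦ b ^ i a b ^ (-i)`. The other two choices rest on Sanov's free group generated by the shears of
`ℤ²` with off-diagonal entry `2`, treated by ping-pong (`FreeGroup.injective_of_sanov`).
For a rootless element of a normal subgroup `N`, the free group is represented faithfully in
`SL₂(ℤ[X])` with `x_0` a shear. For `u ∈ N` with lower left entry `c ≠ 0`, the commutator of `u` with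
`x_0 ^ q` has trace `2 + (q X c) ^ 2`, and for a prime `q` not dividing the leading coefficient of `c`
this is not the trace of a proper power (`Matrix.SpecialLinearGroup.not_hasRoot_of_trace`).
For the braid groups, the squares of `σ_1`, `σ_2` commute with `σ_4 ^ 2` and with the braid that
passes the fourth strand around the first three. Under the Burau representation at `t = -1` both pairs act
on suitable vectors by Sanov's shears, so both generate free groups; two commuting free groups of
rank two meet trivially, because the free group of rank two has trivial center.
-/

/-! ### Free groups: commuting elements, roots, and embeddings into the free group of rank two -/

theorem FreeGroup.eq_of_of_mul_of_comm {α : Type*} {x y : α}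
    (h : FreeGroup.of x * FreeGroup.of y = FreeGroup.of y * FreeGroup.of x) : x = y := by
  classical
  by_contra hxy
  let f : α → Equiv.Perm (Fin 3) := fun z => if z = x then Equiv.swap 0 1 else Equiv.swap 1 2
  have h1 := congrArg (FreeGroup.lift f) h
  simp only [_root_.map_mul, FreeGroup.lift_apply_of, f, if_true, if_neg (Ne.symm hxy)] at h1
  exact absurd h1 (by decide)

theorem FreeGroup.mem_zpowers_of {α : Type*} [Subsingleton α] (x : α) (g : FreeGroup α) :
    g ∈ Subgroup.zpowers (FreeGroup.of x) := by
  induction g using FreeGroup.induction_on with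
  | C1 => exact one_mem _
  | of y => rw [Subsingleton.elim y x]; exact Subgroup.mem_zpowers _
  | inv_of y h => exact inv_mem h
  | mul a b ha hb => exact mul_mem ha hb

/-- A free group that is commutative is cyclic, as it has at most one free generator. -/
theorem IsFreeGroup.exists_forall_mem_zpowers {G : Type*} [Group G] [IsFreeGroup G]
    (hG : ∀ x y : G, x * y = y * x) : ∃ w : G, ∀ g : G, g ∈ Subgroup.zpowers w := by
  let e := IsFreeGroup.toFreeGroup G
  have hs : Subsingleton (IsFreeGroup.Generators G) := ⟨fun x y =>
    FreeGroup.eq_of_of_mul_of_comm (by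
      apply e.symm.injective
      rw [map_mul, map_mul, hG])⟩
  rcases isEmpty_or_nonempty (IsFreeGroup.Generators G) with h | ⟨⟨x⟩⟩
  · exact ⟨1, fun g => by
      have : e g = e 1 := Subsingleton.elim _ _
      rw [e.injective this]
      exact one_mem _⟩
  · refine ⟨e.symm (FreeGroup.of x), fun g => ?_⟩
    obtain ⟨k, hk⟩ := FreeGroup.mem_zpowers_of x (e g)
    refine ⟨k, e.injective ?_⟩
    simpa using hk

/-- The subgroup generated by two commuting elements is free by the Nielsen–Schreier theorem, and
commutative. -/
theorem Commute.exists_mem_zpowers_of_isFreeGroup {F : Type*} [Group F] [IsFreeGroup F] {a b : F}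
    (h : Commute a b) : ∃ w : F, a ∈ Subgroup.zpowers w ∧ b ∈ Subgroup.zpowers w := by
  have hc : ∀ x ∈ ({a, b} : Set F), ∀ y ∈ ({a, b} : Set F), x * y = y * x := by
    rintro x (rfl | rfl) y (rfl | rfl)
    exacts [rfl, h.eq, h.eq.symm, rfl]
  have hK : ∀ x y : Subgroup.closure ({a, b} : Set F), x * y = y * x :=
    (Subgroup.isMulCommutative_closure hc).is_comm.comm
  obtain ⟨w, hw⟩ := IsFreeGroup.exists_forall_mem_zpowers hK
  refine ⟨w, ?_, ?_⟩
  · obtain ⟨k, hk⟩ := hw ⟨a, Subgroup.subset_closure (by simp)⟩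
    exact ⟨k, by simpa using congrArg Subtype.val hk⟩
  · obtain ⟨k, hk⟩ := hw ⟨b, Subgroup.subset_closure (by simp)⟩
    exact ⟨k, by simpa using congrArg Subtype.val hk⟩

theorem Commute.mem_zpowers_of_not_hasRoot {F : Type*} [Group F] [IsFreeGroup F] {H c : F}
    (hH : ¬ HasRoot H) (h : Commute H c) : c ∈ Subgroup.zpowers H := by
  obtain ⟨w, ⟨k, hk⟩, hc⟩ := h.exists_mem_zpowers_of_isFreeGroup
  have hk' : k = 1 ∨ k = -1 := by
    by_contra hcon
    push Not at hcon
    exact hH ⟨w, k, hcon.1, hcon.2, hk.symm⟩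
  have hk : w ^ k = H := hk
  rcases hk' with rfl | rfl
  · rw [zpow_one] at hk
    rwa [← hk]
  · rw [zpow_neg_one] at hk
    rwa [← hk, Subgroup.zpowers_inv]

open Classical in
/-- The exponent sum of the generator `x`. -/
noncomputable def FreeGroup.exponentSum {α : Type*} (x : α) : FreeGroup α →* Multiplicative ℤ :=
  FreeGroup.lift fun y => if y = x then Multiplicative.ofAdd 1 else 1

theorem FreeGroup.exponentSum_of_self {α : Type*} (x : α) :
    FreeGroup.exponentSum x (FreeGroup.of x) = Multiplicative.ofAdd 1 := by
  simp [exponentSum]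

theorem FreeGroup.exponentSum_of_ne {α : Type*} {x y : α} (h : y ≠ x) :
    FreeGroup.exponentSum x (FreeGroup.of y) = 1 := by
  simp [exponentSum, h]

theorem FreeGroup.not_hasRoot_of {α : Type*} (x : α) : ¬ HasRoot (FreeGroup.of x) := by
  rintro ⟨w, k, h1, h2, h⟩
  have h3 := congrArg (fun g => (FreeGroup.exponentSum x g).toAdd) h
  simp only [exponentSum_of_self, map_zpow, toAdd_ofAdd, toAdd_zpow, smul_eq_mul] at h3
  rcases Int.isUnit_iff.1 (IsUnit.of_mul_eq_one _ h3.symm) with h | h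
  exacts [h1 h, h2 h]

theorem FreeGroup.eq_one_of_forall_commute {α : Type*} {x y : α} (hxy : x ≠ y) {g : FreeGroup α}
    (hx : Commute (FreeGroup.of x) g) (hy : Commute (FreeGroup.of y) g) : g = 1 := by
  obtain ⟨k, rfl⟩ := hx.mem_zpowers_of_not_hasRoot (FreeGroup.not_hasRoot_of x)
  obtain ⟨l, hl⟩ := hy.mem_zpowers_of_not_hasRoot (FreeGroup.not_hasRoot_of y)
  have h := congrArg (fun g => (FreeGroup.exponentSum x g).toAdd) hl
  simp only [map_zpow, exponentSum_of_self, exponentSum_of_ne hxy.symm, toAdd_zpow, toAdd_one,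
    toAdd_ofAdd, smul_eq_mul, mul_zero, mul_one] at h
  simp [← h]

/-- Permutations of the generators act on a free group by automorphisms. -/
def FreeGroup.permAut (α : Type*) : Equiv.Perm α →* MulAut (FreeGroup α) where
  toFun s := FreeGroup.freeGroupCongr s
  map_one' := by ext x; simp
  map_mul' s t := by ext x; simp [FreeGroup.map.comp]

/-- The homomorphism `x_i ↦ b ^ i a b ^ (-i)` to the free group on `a`, `b`. -/
def FreeGroup.toRankTwo (r : ℕ) : FreeGroup (Fin r) →* FreeGroup (Fin 2) :=
  FreeGroup.lift fun i => FreeGroup.of 1 ^ (i : ℕ) * FreeGroup.of 0 * (FreeGroup.of 1 ^ (i : ℕ))⁻¹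

/-- The free group on `x_i`, `i ∈ ℤ`, is extended by the shift of the indices. Sending `a` to `x_0`
and `b` to the shift takes `b ^ i a b ^ (-i)` to `x_i`, so no relation can hold between these. -/
theorem FreeGroup.toRankTwo_injective (r : ℕ) :
    Function.Injective (FreeGroup.toRankTwo r) := by
  let b : FreeGroup ℤ ⋊[FreeGroup.permAut ℤ] Equiv.Perm ℤ :=
    SemidirectProduct.inr (Equiv.addRight 1)
  let ψ : FreeGroup (Fin 2) →* FreeGroup ℤ ⋊[FreeGroup.permAut ℤ] Equiv.Perm ℤ :=
    FreeGroup.lift ![SemidirectProduct.inl (FreeGroup.of 0), b]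
  have hb : ∀ i : ℕ, b ^ i * SemidirectProduct.inl (FreeGroup.of 0) * (b ^ i)⁻¹ =
      SemidirectProduct.inl (FreeGroup.of (i : ℤ)) := by
    intro i
    rw [← map_pow, ← _root_.map_inv, ← SemidirectProduct.inl_aut]
    simp [permAut]
  have hcomp : ψ.comp (FreeGroup.toRankTwo r) =
      SemidirectProduct.inl.comp (FreeGroup.map fun i : Fin r => ((i : ℕ) : ℤ)) := by
    ext1 i
    simp [ψ, toRankTwo, hb]
  have hinj : Function.Injective (ψ.comp (FreeGroup.toRankTwo r)) := by
    rw [hcomp]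
    exact SemidirectProduct.inl_injective.comp
      (FreeGroup.map_injective (fun i j h => by simpa [Fin.ext_iff] using h))
  exact Function.Injective.of_comp (f := ψ) hinj

/-! ### Sanov's free group -/

/-- Integer vectors whose coordinates have odd sum. The two coordinates of such a vector never
have the same absolute value, so one of them dominates; this is what ping-pong needs. -/
abbrev OddVec : Type := {v : ℤ × ℤ // Odd (v.1 + v.2)}

/-- The shears `(p, q) ↦ (p + 2q, q)` and `(p, q) ↦ (p, q + 2p)` of `OddVec`. -/
def sanovPerm : Fin 2 → Equiv.Perm OddVec :=
  ![{ toFun := fun v => ⟨(v.1.1 + 2 * v.1.2, v.1.2), by have := v.2; grind⟩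
      invFun := fun v => ⟨(v.1.1 - 2 * v.1.2, v.1.2), by have := v.2; grind⟩
      left_inv := fun v => by ext <;> simp
      right_inv := fun v => by ext <;> simp },
    { toFun := fun v => ⟨(v.1.1, v.1.2 + 2 * v.1.1), by have := v.2; grind⟩
      invFun := fun v => ⟨(v.1.1, v.1.2 - 2 * v.1.1), by have := v.2; grind⟩
      left_inv := fun v => by ext <;> simp
      right_inv := fun v => by ext <;> simp }]

theorem Int.abs_lt_abs_add_two_mul {p q : ℤ} (hne : |p| ≠ |q|) (h : ¬ (|q| < |p| ∧ p * q < 0)) :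
    |q| < |p + 2 * q| ∧ 0 ≤ (p + 2 * q) * q := by
  rw [mul_neg_iff] at h
  rw [mul_nonneg_iff]
  rcases abs_cases p with h1 | h1 <;> rcases abs_cases q with h2 | h2 <;>
    rcases abs_cases (p + 2 * q) with h3 | h3 <;> omega

theorem Int.abs_lt_abs_sub_two_mul {p q : ℤ} (hne : |p| ≠ |q|) (h : ¬ (|q| < |p| ∧ 0 ≤ p * q)) :
    |q| < |p - 2 * q| ∧ (p - 2 * q) * q < 0 := by
  rw [mul_nonneg_iff] at h
  rw [mul_neg_iff]
  rcases abs_cases p with h1 | h1 <;> rcases abs_cases q with h2 | h2 <;>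
    rcases abs_cases (p - 2 * q) with h3 | h3 <;> omega

theorem sanovPerm_injective : Function.Injective (FreeGroup.lift sanovPerm) := by
  -- The vectors dominated by the coordinate that the shear changes, split by the sign of `p * q`.
  let X : Fin 2 → Set OddVec :=
    ![{v | |v.1.2| < |v.1.1| ∧ 0 ≤ v.1.1 * v.1.2}, {v | |v.1.1| < |v.1.2| ∧ 0 ≤ v.1.1 * v.1.2}]
  let Y : Fin 2 → Set OddVec :=
    ![{v | |v.1.2| < |v.1.1| ∧ v.1.1 * v.1.2 < 0}, {v | |v.1.1| < |v.1.2| ∧ v.1.1 * v.1.2 < 0}]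
  have hne : ∀ v : OddVec, |v.1.1| ≠ |v.1.2| := by
    rintro ⟨⟨p, q⟩, h⟩
    simp only at h ⊢
    rw [Ne, abs_eq_abs]
    rintro (rfl | rfl) <;> grind
  apply FreeGroup.injective_lift_of_ping_pong sanovPerm X Y
  · intro i
    fin_cases i
    · exact ⟨⟨(1, 0), by decide⟩, by simp [X]⟩
    · exact ⟨⟨(0, 1), by decide⟩, by simp [X]⟩
  · intro i j hij
    rw [Function.onFun, Set.disjoint_left]
    fin_cases i <;> fin_cases j <;> try exact absurd rfl hij
    all_goals simp only [X, Set.mem_ofPred_eq, Matrix.cons_val_zero, Matrix.cons_val_one,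
      Fin.mk_zero, Fin.mk_one, Fin.isValue]; rintro v ⟨h1, -⟩ ⟨h2, -⟩; omega
  · intro i j hij
    rw [Function.onFun, Set.disjoint_left]
    fin_cases i <;> fin_cases j <;> try exact absurd rfl hij
    all_goals simp only [Y, Set.mem_ofPred_eq, Matrix.cons_val_zero, Matrix.cons_val_one,
      Fin.mk_zero, Fin.mk_one, Fin.isValue]; rintro v ⟨h1, -⟩ ⟨h2, -⟩; omega
  · intro i j
    rw [Set.disjoint_left]
    fin_cases i <;> fin_cases j
    all_goals simp only [X, Y, Set.mem_ofPred_eq, Matrix.cons_val_zero, Matrix.cons_val_one,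
      Fin.mk_zero, Fin.mk_one, Fin.isValue]; rintro v ⟨h1, h3⟩ ⟨h2, h4⟩; omega
  · intro i
    rw [Set.smul_set_subset_iff]
    intro v hv
    fin_cases i
    · exact Int.abs_lt_abs_add_two_mul (hne v) hv
    · have := Int.abs_lt_abs_add_two_mul (hne v).symm (by rw [mul_comm]; exact hv)
      exact ⟨this.1, by rw [mul_comm]; exact this.2⟩
  · intro i
    rw [Set.smul_set_subset_iff]
    intro v hv
    fin_cases i
    · exact Int.abs_lt_abs_sub_two_mul (hne v) hv
    · have := Int.abs_lt_abs_sub_two_mul (hne v).symm (by rw [mul_comm]; exact hv)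
      exact ⟨this.1, by rw [mul_comm]; exact this.2⟩

/-- A homomorphism from the free group of rank two is injective if the two generators act on some
set of odd vectors by Sanov's shears. -/
theorem FreeGroup.injective_of_sanov {G β : Type*} [Group G] [MulAction G β]
    (φ : FreeGroup (Fin 2) →* G) (e : OddVec → β) (he : Function.Injective e)
    (hφ : ∀ i v, φ (FreeGroup.of i) • e v = e (sanovPerm i v)) : Function.Injective φ := by
  have key : ∀ w v, φ w • e v = e (FreeGroup.lift sanovPerm w v) := by
    intro w
    induction w using FreeGroup.induction_on with
    | C1 => simp
    | of i => simpa using hφ i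
    | inv_of i h =>
      intro v
      rw [_root_.map_inv, inv_smul_eq_iff, h]
      simp
    | mul a b ha hb =>
      intro v
      rw [_root_.map_mul, mul_smul, hb, ha, _root_.map_mul, Equiv.Perm.mul_apply]
  rw [injective_iff_map_eq_one]
  intro w hw
  apply (injective_iff_map_eq_one _).1 sanovPerm_injective
  ext1 v
  apply he
  rw [← key, hw, one_smul, Equiv.Perm.one_apply]

/-! ### Rootless elements of normal subgroups of free groups -/

section Trace

open Polynomial
open scoped MatrixGroups

theorem Matrix.SpecialLinearGroup.trace_pow_add_two {R : Type*} [CommRing R] (w : SL(2, R)) (n : ℕ) :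
    ((w ^ (n + 2) : SL(2, R)) : Matrix (Fin 2) (Fin 2) R).trace =
      (w : Matrix (Fin 2) (Fin 2) R).trace *
          ((w ^ (n + 1) : SL(2, R)) : Matrix (Fin 2) (Fin 2) R).trace -
        ((w ^ n : SL(2, R)) : Matrix (Fin 2) (Fin 2) R).trace := by
  have hdet := w.det_coe
  rw [Matrix.det_fin_two] at hdet
  rw [pow_add w n 2, pow_succ w n, pow_two]
  simp only [Matrix.SpecialLinearGroup.coe_mul, Matrix.trace_fin_two, Matrix.mul_apply,
    Fin.sum_univ_two]
  generalize (w : Matrix (Fin 2) (Fin 2) R) 0 0 = a at *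
  generalize (w : Matrix (Fin 2) (Fin 2) R) 0 1 = b at *
  generalize (w : Matrix (Fin 2) (Fin 2) R) 1 0 = c at *
  generalize (w : Matrix (Fin 2) (Fin 2) R) 1 1 = d at *
  linear_combination
    (-((w ^ n : SL(2, R)) : Matrix (Fin 2) (Fin 2) R) 0 0 -
      ((w ^ n : SL(2, R)) : Matrix (Fin 2) (Fin 2) R) 1 1) * hdet

/-- The trace of the commutator of a matrix with an upper shear. -/
theorem Matrix.SpecialLinearGroup.trace_commutator_shear {R : Type*} [CommRing R] (v u : SL(2, R))
    {T : R} (hu : (u : Matrix (Fin 2) (Fin 2) R) = !![1, T; 0, 1]) :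
    ((v * u * v⁻¹ * u⁻¹ : SL(2, R)) : Matrix (Fin 2) (Fin 2) R).trace = 2 + (T * v 1 0) ^ 2 := by
  have hdet := v.det_coe
  rw [Matrix.det_fin_two] at hdet
  simp only [Matrix.SpecialLinearGroup.coe_mul, Matrix.SpecialLinearGroup.coe_inv, hu,
    Matrix.adjugate_fin_two, Matrix.trace_fin_two, Matrix.mul_apply, Fin.sum_univ_two]
  simp
  generalize (v : Matrix (Fin 2) (Fin 2) R) 0 0 = a at *
  generalize (v : Matrix (Fin 2) (Fin 2) R) 0 1 = b at *
  generalize (v : Matrix (Fin 2) (Fin 2) R) 1 0 = c at *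
  generalize (v : Matrix (Fin 2) (Fin 2) R) 1 1 = d at *
  linear_combination 2 * hdet

/-- The trace of `w ^ n` is a polynomial of degree `n` in the trace of `w`, monic if `0 < n`. -/
theorem Matrix.SpecialLinearGroup.natDegree_trace_pow_le (w : SL(2, ℤ[X])) (n : ℕ) :
    ((w ^ n : SL(2, ℤ[X])) : Matrix (Fin 2) (Fin 2) ℤ[X]).trace.natDegree ≤
      n * (w : Matrix (Fin 2) (Fin 2) ℤ[X]).trace.natDegree := by
  induction n using Nat.twoStepInduction with
  | zero => simp
  | one => simp
  | more n h1 h2 =>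
    rw [trace_pow_add_two]
    refine (natDegree_sub_le _ _).trans (max_le (natDegree_mul_le.trans ?_) (h1.trans ?_))
    · linarith
    · gcongr; omega

theorem Matrix.SpecialLinearGroup.coeff_trace_pow (w : SL(2, ℤ[X]))
    (hw : 0 < (w : Matrix (Fin 2) (Fin 2) ℤ[X]).trace.natDegree) (n : ℕ) :
    ((w ^ (n + 1) : SL(2, ℤ[X])) : Matrix (Fin 2) (Fin 2) ℤ[X]).trace.coeff
        ((n + 1) * (w : Matrix (Fin 2) (Fin 2) ℤ[X]).trace.natDegree) =
      (w : Matrix (Fin 2) (Fin 2) ℤ[X]).trace.leadingCoeff ^ (n + 1) := by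
  induction n with
  | zero => simp
  | succ n h =>
    rw [trace_pow_add_two, coeff_sub,
      coeff_eq_zero_of_natDegree_lt (lt_of_le_of_lt (natDegree_trace_pow_le w n) (by nlinarith)),
      show (n + 1 + 1) * (w : Matrix (Fin 2) (Fin 2) ℤ[X]).trace.natDegree =
        (w : Matrix (Fin 2) (Fin 2) ℤ[X]).trace.natDegree +
          (n + 1) * (w : Matrix (Fin 2) (Fin 2) ℤ[X]).trace.natDegree by ring,
      coeff_mul_add_eq_of_natDegree_le le_rfl (natDegree_trace_pow_le w (n + 1)), h, sub_zero,
      coeff_natDegree, pow_succ' _ (n + 1)]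

/-- Comparing leading coefficients, a `d`-th power can only have such a trace for `d ∣ 2`; a square
cannot, as `4 = s ^ 2 - (q X c) ^ 2` would factor with a factor of positive degree. -/
theorem Matrix.SpecialLinearGroup.not_hasRoot_of_trace {g : SL(2, ℤ[X])} {c : ℤ[X]} {q : ℤ}
    (hc : c ≠ 0) (hq : Prime q) (hqc : ¬ q ∣ c.leadingCoeff)
    (hg : (g : Matrix (Fin 2) (Fin 2) ℤ[X]).trace = 2 + (C q * X * c) ^ 2) : ¬ HasRoot g := by
  have hq0 : (C q : ℤ[X]) ≠ 0 := by simpa using hq.ne_zero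
  set A : ℤ[X] := C q * X * c with hA
  have hAdeg : A.natDegree = c.natDegree + 1 := by
    rw [hA, natDegree_mul (mul_ne_zero hq0 X_ne_zero) hc, natDegree_mul hq0 X_ne_zero]
    simp [add_comm]
  have hAlc : A.leadingCoeff = q * c.leadingCoeff := by
    rw [hA, leadingCoeff_mul, leadingCoeff_mul, leadingCoeff_C, leadingCoeff_X, mul_one]
  have hlt : (2 : ℤ[X]).natDegree < (A ^ 2).natDegree := by
    rw [natDegree_pow, hAdeg, show (2 : ℤ[X]) = C 2 from rfl, natDegree_C]; omega
  have hdeg : (2 + A ^ 2).natDegree = 2 * (c.natDegree + 1) := by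
    rw [natDegree_add_eq_right_of_natDegree_lt hlt, natDegree_pow, hAdeg]
  have hlc : (2 + A ^ 2).leadingCoeff = (q * c.leadingCoeff) ^ 2 := by
    rw [leadingCoeff_add_of_degree_lt (degree_lt_degree hlt), leadingCoeff_pow, hAlc]
  have main : ∀ (w : SL(2, ℤ[X])) (d : ℕ), d ≠ 1 → g ≠ w ^ d := by
    rintro w d hd rfl
    obtain _ | _ | d := d
    · rw [pow_zero] at hg
      have := congrArg natDegree hg
      rw [hdeg] at this
      simp at this
    · exact hd rfl
    have hle := natDegree_trace_pow_le w (d + 2)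
    rw [hg, hdeg] at hle
    have hpos : 0 < (w : Matrix (Fin 2) (Fin 2) ℤ[X]).trace.natDegree := by
      rcases Nat.eq_zero_or_pos (w : Matrix (Fin 2) (Fin 2) ℤ[X]).trace.natDegree with h | h
      · rw [h] at hle; omega
      · exact h
    have hco := coeff_trace_pow w hpos (d + 1)
    set s := (w : Matrix (Fin 2) (Fin 2) ℤ[X]).trace with hs
    have hs0 : s.leadingCoeff ≠ 0 := by
      rw [Ne, leadingCoeff_eq_zero]
      rintro h
      simp [h] at hpos
    rw [hg] at hco
    have hdeg2 : (d + 1 + 1) * s.natDegree = (2 + A ^ 2).natDegree := by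
      refine le_antisymm (le_natDegree_of_ne_zero ?_) (by rw [hdeg]; exact hle)
      rw [hco]
      exact pow_ne_zero _ hs0
    rw [hdeg2, coeff_natDegree, hlc] at hco
    have hqs : q ∣ s.leadingCoeff :=
      hq.dvd_of_dvd_pow (n := d + 1 + 1)
        (hco ▸ (dvd_mul_right _ _).trans (dvd_pow_self _ two_ne_zero))
    obtain _ | d := d
    · rw [trace_pow_add_two, zero_add, pow_one, pow_zero, ← hs] at hg
      have h4 : (s - A) * (s + A) = 4 := by
        simp only [Matrix.SpecialLinearGroup.coe_one, Matrix.trace_one, Fintype.card_fin] at hg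
        push_cast at hg
        linear_combination hg
      have hz := congrArg natDegree h4
      have h40 : (4 : ℤ[X]) ≠ 0 := by norm_num
      rw [natDegree_mul (fun h => h40 (by rw [← h4, h, zero_mul]))
        (fun h => h40 (by rw [← h4, h, mul_zero])), show (4 : ℤ[X]) = C 4 from rfl,
        natDegree_C] at hz
      have h2A : (2 * A).natDegree ≤ 0 := by
        rw [show 2 * A = (s + A) - (s - A) by ring]
        exact (natDegree_sub_le _ _).trans (max_le (by omega) (by omega))
      rw [show (2 : ℤ[X]) = C 2 from rfl, natDegree_C_mul two_ne_zero, hAdeg] at h2A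
      omega
    · have h3 : q ^ 3 ∣ (q * c.leadingCoeff) ^ 2 := by
        rw [hco]
        exact (pow_dvd_pow_of_dvd hqs 3).trans (pow_dvd_pow _ (by omega))
      rw [mul_pow, pow_succ q 2, mul_dvd_mul_iff_left (pow_ne_zero 2 hq.ne_zero)] at h3
      exact hqc (hq.dvd_of_dvd_pow h3)
  rintro ⟨w, k, h1, h2, h⟩
  rcases Int.natAbs_eq k with hk | hk
  · rw [hk, zpow_natCast] at h
    exact main w k.natAbs (by omega) h
  · rw [hk, _root_.zpow_neg, zpow_natCast, ← inv_pow] at h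
    exact main w⁻¹ k.natAbs (by omega) h

/-- The images `1 + X E₁₂` and `1 + X E₂₁` of the generators under `sanovPoly`. -/
noncomputable def sanovPolyGen : Fin 2 → SL(2, ℤ[X]) :=
  ![⟨!![1, X; 0, 1], by simp [Matrix.det_fin_two]⟩, ⟨!![1, 0; X, 1], by simp [Matrix.det_fin_two]⟩]

/-- The representation of the free group of rank two by polynomial matrices that specializes to
Sanov's at `X = 2`. -/
noncomputable def sanovPoly : FreeGroup (Fin 2) →* SL(2, ℤ[X]) := FreeGroup.lift sanovPolyGen

theorem sanovPoly_injective : Function.Injective sanovPoly := by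
  let ψ : SL(2, ℤ[X]) →* ((Fin 2 → ℤ) ≃ₗ[ℤ] (Fin 2 → ℤ)) :=
    (Matrix.SpecialLinearGroup.toLin' (n := Fin 2) (R := ℤ)).comp
      (Matrix.SpecialLinearGroup.map (evalRingHom (2 : ℤ)))
  have h : Function.Injective (ψ.comp sanovPoly) := by
    refine FreeGroup.injective_of_sanov (ψ.comp sanovPoly) (fun v : OddVec => ![v.1.1, v.1.2]) ?_ ?_
    · intro v w hvw
      have h0 := congrFun hvw 0
      have h1 := congrFun hvw 1
      exact Subtype.ext (Prod.ext h0 h1)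
    · intro i v
      fin_cases i
      all_goals
        ext j
        change ((sanovPoly (FreeGroup.of _) : Matrix (Fin 2) (Fin 2) ℤ[X]).map (evalRingHom 2)).mulVec
          ![v.1.1, v.1.2] j = _
        fin_cases j <;>
          simp [sanovPoly, sanovPolyGen, sanovPerm, Matrix.mulVec, dotProduct, Fin.sum_univ_two,
            add_comm]
  exact Function.Injective.of_comp (f := ψ) h

theorem sanovPoly_of_zero_pow (n : ℕ) :
    (sanovPoly (FreeGroup.of 0 ^ n) : Matrix (Fin 2) (Fin 2) ℤ[X]) =
      !![1, C (n : ℤ) * X; 0, 1] := by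
  induction n with
  | zero => simp [Matrix.one_fin_two]
  | succ n ih =>
    rw [pow_succ, _root_.map_mul, Matrix.SpecialLinearGroup.coe_mul, ih]
    simp [sanovPoly, sanovPolyGen]
    ring

/-- The units of `ℤ[X]` are `1` and `-1`, which are their own inverses. -/
theorem Polynomial.int_eq_of_mul_eq_one {a d : ℤ[X]} (h : a * d = 1) : a = d := by
  obtain ⟨r, hr, rfl⟩ := Polynomial.isUnit_iff.1 (IsUnit.of_mul_eq_one _ h)
  rcases Int.isUnit_iff.1 hr with rfl | rfl
  · simpa using h.symm
  · rw [C_neg, C_1, neg_one_mul] at h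
    rw [C_neg, C_1, ← h, neg_neg]

/-- A nontrivial normal subgroup of a free group of rank at least two has an element with nonzero
lower left entry: an upper triangular matrix of determinant one over `ℤ[X]` commutes with the image
of `x_0`, and `x_0` does not commute with all the conjugates of a nontrivial element. -/
theorem exists_sanovPoly_ne_zero {k : ℕ} (hk : 2 ≤ k) (N : Subgroup (FreeGroup (Fin k))) [N.Normal]
    {v : FreeGroup (Fin k)} (hv : v ∈ N) (hv1 : v ≠ 1) :
    ∃ u ∈ N, (sanovPoly (FreeGroup.toRankTwo k u) : Matrix (Fin 2) (Fin 2) ℤ[X]) 1 0 ≠ 0 := by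
  by_contra! hcon
  let x : FreeGroup (Fin k) := FreeGroup.of ⟨0, by omega⟩
  let y : FreeGroup (Fin k) := FreeGroup.of ⟨1, by omega⟩
  have hx : FreeGroup.toRankTwo k x = FreeGroup.of 0 := by simp [FreeGroup.toRankTwo, x]
  have hcomm : ∀ u ∈ N, Commute x u := by
    intro u hu
    apply FreeGroup.toRankTwo_injective k
    apply sanovPoly_injective
    have h0 := hcon u hu
    rw [_root_.map_mul, _root_.map_mul, _root_.map_mul, _root_.map_mul, hx]
    set w := sanovPoly (FreeGroup.toRankTwo k u)
    have hdet := w.det_coe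
    rw [Matrix.det_fin_two, h0, mul_zero, sub_zero] at hdet
    have had := Polynomial.int_eq_of_mul_eq_one hdet
    have hU : (sanovPoly (FreeGroup.of 0) : Matrix (Fin 2) (Fin 2) ℤ[X]) = !![1, X; 0, 1] := by
      simp [sanovPoly, sanovPolyGen]
    refine Matrix.SpecialLinearGroup.ext _ _ fun i j => ?_
    simp only [Matrix.SpecialLinearGroup.coe_mul, Matrix.mul_apply, Fin.sum_univ_two, hU]
    fin_cases i <;> fin_cases j <;> simp [h0, had]
    ring
  obtain ⟨s, hs⟩ := (hcomm v hv).mem_zpowers_of_not_hasRoot (FreeGroup.not_hasRoot_of _)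
  obtain ⟨r, hr⟩ := (hcomm _ (Subgroup.Normal.conj_mem ‹_› v hv y)).mem_zpowers_of_not_hasRoot
    (FreeGroup.not_hasRoot_of _)
  simp only at hs hr
  -- Conjugation preserves exponent sums.
  have hrs : r = s := by
    have h := congrArg (fun g => (FreeGroup.exponentSum (⟨0, by omega⟩ : Fin k) g).toAdd) hr
    simpa [← hs, x, FreeGroup.exponentSum_of_self, mul_comm] using h
  rw [hrs, hs, eq_mul_inv_iff_mul_eq] at hr
  exact hv1 (FreeGroup.eq_one_of_forall_commute (x := (⟨0, by omega⟩ : Fin k)) (y := ⟨1, by omega⟩)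
    (by simp) (hcomm v hv) hr.symm)

/-- The rootless element is a commutator of an element of `N` with a prime power of a generator. -/
theorem exists_mem_not_hasRoot {k : ℕ} (hk : 2 ≤ k) (N : Subgroup (FreeGroup (Fin k)))
    [hN : N.Normal] {v : FreeGroup (Fin k)} (hv : v ∈ N) (hv1 : v ≠ 1) : ∃ g ∈ N, ¬ HasRoot g := by
  obtain ⟨u, hu, hc⟩ := exists_sanovPoly_ne_zero hk N hv hv1
  let Φ := sanovPoly.comp (FreeGroup.toRankTwo k)
  let x : FreeGroup (Fin k) := FreeGroup.of ⟨0, by omega⟩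
  have hx : FreeGroup.toRankTwo k x = FreeGroup.of 0 := by simp [FreeGroup.toRankTwo, x]
  set c := (sanovPoly (FreeGroup.toRankTwo k u) : Matrix (Fin 2) (Fin 2) ℤ[X]) 1 0 with hcdef
  -- A prime larger than the leading coefficient of `c` does not divide it.
  obtain ⟨q, hqgt, hq⟩ := Nat.exists_infinite_primes (c.leadingCoeff.natAbs + 1)
  have hqc : ¬ (q : ℤ) ∣ c.leadingCoeff := by
    intro h
    have := Nat.le_of_dvd (Int.natAbs_pos.2 (leadingCoeff_ne_zero.2 hc)) (Int.natCast_dvd.1 h)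
    omega
  refine ⟨u * x ^ q * u⁻¹ * (x ^ q)⁻¹, ?_, ?_⟩
  · rw [mul_assoc, mul_assoc]
    refine N.mul_mem hu ?_
    rw [← mul_assoc]
    exact hN.conj_mem _ (N.inv_mem hu) _
  · have hroot : ∀ g : FreeGroup (Fin k), HasRoot g → HasRoot (Φ g) := by
      rintro g ⟨w, k, h1, h2, rfl⟩
      exact ⟨Φ w, k, h1, h2, _root_.map_zpow _ _ _⟩
    refine fun h => Matrix.SpecialLinearGroup.not_hasRoot_of_trace hc (Nat.prime_iff_prime_int.1 hq)
      hqc ?_ (hroot _ h)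
    simp only [Φ, _root_.map_mul, _root_.map_inv, MonoidHom.comp_apply]
    rw [Matrix.SpecialLinearGroup.trace_commutator_shear (T := C (q : ℤ) * X)]
    rw [_root_.map_pow, hx, sanovPoly_of_zero_pow]

end Trace

/-! ### The product of two free groups of rank two in the braid group -/

theorem MonoidHom.injective_noncommCoprod_of_center {F K G : Type*} [Group F] [Group K] [Group G]
    (hF : ∀ z : F, (∀ x, Commute x z) → z = 1) (f : F →* G) (g : K →* G)
    (hf : Function.Injective f) (hg : Function.Injective g) (h : ∀ x y, Commute (f x) (g y)) :
    Function.Injective (f.noncommCoprod g h) := by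
  rw [injective_iff_map_eq_one]
  rintro ⟨x, y⟩ hxy
  rw [MonoidHom.noncommCoprod_apply] at hxy
  have hx : x = 1 := hF x fun z => by
    apply hf
    rw [_root_.map_mul, _root_.map_mul, eq_inv_of_mul_eq_one_left hxy]
    exact (h z y).inv_right.eq
  subst hx
  rw [_root_.map_one, one_mul] at hxy
  rw [(injective_iff_map_eq_one g).1 hg y hxy]
  rfl

theorem FreeGroup.commute_lift {α β G : Type*} [Group G] {f : α → G} {g : β → G}
    (h : ∀ a b, Commute (f a) (g b)) (x : FreeGroup α) (y : FreeGroup β) :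
    Commute (FreeGroup.lift f x) (FreeGroup.lift g y) := by
  induction x using FreeGroup.induction_on with
  | C1 => simp
  | of a =>
    induction y using FreeGroup.induction_on with
    | C1 => simp
    | of b => simpa using h a b
    | inv_of b hb => rw [_root_.map_inv]; exact hb.inv_right
    | mul a b ha hb => rw [_root_.map_mul]; exact ha.mul_right hb
  | inv_of b hb => rw [_root_.map_inv]; exact hb.inv_left
  | mul a b ha hb => rw [_root_.map_mul]; exact ha.mul_left hb

/-- The transvection `v_{i+1} ↦ v_{i+1} + v_i - v_{i+2}` of integer sequences. -/
def burauPerm (i : ℕ) : Equiv.Perm (ℕ → ℤ) where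
  toFun v k := if k = i + 1 then v (i + 1) + v i - v (i + 2) else v k
  invFun v k := if k = i + 1 then v (i + 1) - v i + v (i + 2) else v k
  left_inv v := by
    funext k
    by_cases h : k = i + 1
    · subst h; simp; ring
    · simp [h]
  right_inv v := by
    funext k
    by_cases h : k = i + 1
    · subst h; simp; ring
    · simp [h]

theorem burauPerm_apply (i : ℕ) (v : ℕ → ℤ) (k : ℕ) :
    burauPerm i v k = if k = i + 1 then v (i + 1) + v i - v (i + 2) else v k := rfl

/-- The action of the braid group on integer sequences in which `σ_i` acts by a transvection. It is
the Burau representation at `t = -1`, on the coordinates `1, …, n - 1`; all other coordinates are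
fixed, and `0` and `n` act as boundary values. -/
def burauHom (n : ℕ) : BraidGroup n →* Equiv.Perm (ℕ → ℤ) :=
  PresentedGroup.toGroup (rels := braidRels n) (f := fun i : Fin (n - 1) => burauPerm (i : ℕ)) (by
    rintro w (⟨i, j, h, rfl⟩ | ⟨i, j, h, rfl⟩)
    · simp only [_root_.map_mul, _root_.map_inv, FreeGroup.lift_apply_of]
      rw [mul_inv_eq_one, ← h]
      ext v k
      simp only [Equiv.Perm.mul_apply, burauPerm_apply, add_assoc, Nat.reduceAdd]
      split_ifs <;> omega
    · simp only [_root_.map_mul, _root_.map_inv, FreeGroup.lift_apply_of]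
      rw [mul_inv_eq_one]
      ext v k
      simp only [Equiv.Perm.mul_apply, burauPerm_apply]
      split_ifs <;> omega)

theorem burauHom_of {n : ℕ} (i : Fin (n - 1)) :
    burauHom n (PresentedGroup.of i) = burauPerm i := by
  rw [burauHom, PresentedGroup.toGroup.of]

theorem BraidGroup.braid {n : ℕ} {i j : Fin (n - 1)} (h : (i : ℕ) + 1 = j) :
    (PresentedGroup.of i * PresentedGroup.of j * PresentedGroup.of i : BraidGroup n) =
      PresentedGroup.of j * PresentedGroup.of i * PresentedGroup.of j :=
  mul_inv_eq_one.1 (PresentedGroup.one_of_mem (rels := braidRels n) (Or.inl ⟨i, j, h, rfl⟩))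

theorem BraidGroup.comm {n : ℕ} {i j : Fin (n - 1)} (h : (i : ℕ) + 2 ≤ j) :
    Commute (PresentedGroup.of i : BraidGroup n) (PresentedGroup.of j) :=
  mul_inv_eq_one.1 (PresentedGroup.one_of_mem (rels := braidRels n) (Or.inr ⟨i, j, h, rfl⟩))

/-- Passing a strand around a ribbon of three strands commutes with braiding inside the ribbon. -/
theorem commute_of_braid_relations {G : Type*} [Group G] {a b c : G} (hab : a * b * a = b * a * b)
    (hbc : b * c * b = c * b * c) (hac : a * c = c * a) :
    Commute a (c * b * a * a * b * c) ∧ Commute b (c * b * a * a * b * c) := by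
  have h1 : a * b * c * a = b * (a * b * c) := by
    rw [mul_assoc (a * b), ← hac, ← mul_assoc, hab]; simp only [mul_assoc]
  have h2 : a * b * c * b = c * (a * b * c) := by
    rw [mul_assoc a, mul_assoc a, hbc, ← mul_assoc, ← mul_assoc, hac]; simp only [mul_assoc]
  have h3 : c * b * a * b = a * (c * b * a) := by
    rw [mul_assoc c, mul_assoc c, ← hab, ← mul_assoc, ← mul_assoc, ← hac]; simp only [mul_assoc]
  have h4 : c * b * a * c = b * (c * b * a) := by
    rw [mul_assoc (c * b), hac, ← mul_assoc, ← hbc]; simp only [mul_assoc]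
  have he : c * b * a * a * b * c = (c * b * a) * (a * b * c) := by simp only [mul_assoc]
  constructor
  · rw [he, commute_iff_eq, mul_assoc (c * b * a), h1, ← mul_assoc, ← mul_assoc _ b, h3]
  · rw [he, commute_iff_eq, mul_assoc (c * b * a), h2, ← mul_assoc, ← mul_assoc _ c, h4]

section

variable {n : ℕ} (hn : 5 ≤ n)

/-- The squares of `σ_1` and `σ_2` (indices `0` and `1`); the order and the inverse make them act
by Sanov's shears. -/
def braidInner : Fin 2 → BraidGroup n :=
  ![((PresentedGroup.of ⟨0, by omega⟩)⁻¹) ^ 2, (PresentedGroup.of ⟨1, by omega⟩) ^ 2]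

/-- The first three strands form a ribbon; the generators are the braid that passes the fourth
strand around this ribbon, and the full twist of the fourth and fifth strands. -/
def braidOuter : Fin 2 → BraidGroup n :=
  ![(PresentedGroup.of ⟨2, by omega⟩ * PresentedGroup.of ⟨1, by omega⟩ *
      PresentedGroup.of ⟨0, by omega⟩ * PresentedGroup.of ⟨0, by omega⟩ *
      PresentedGroup.of ⟨1, by omega⟩ * PresentedGroup.of ⟨2, by omega⟩)⁻¹,
    (PresentedGroup.of ⟨3, by omega⟩) ^ 2]

theorem commute_braidInner_braidOuter (i j : Fin 2) :
    Commute (braidInner hn i) (braidOuter hn j) := by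
  have h := commute_of_braid_relations
    (BraidGroup.braid (n := n) (i := ⟨0, by omega⟩) (j := ⟨1, by omega⟩) rfl)
    (BraidGroup.braid (n := n) (i := ⟨1, by omega⟩) (j := ⟨2, by omega⟩) rfl)
    (BraidGroup.comm (n := n) (i := ⟨0, by omega⟩) (j := ⟨2, by omega⟩) le_rfl).eq
  have h0 := BraidGroup.comm (n := n) (i := ⟨0, by omega⟩) (j := ⟨3, by omega⟩) (by simp)
  have h1 := BraidGroup.comm (n := n) (i := ⟨1, by omega⟩) (j := ⟨3, by omega⟩) (by simp)
  fin_cases i <;> fin_cases j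
  · exact (h.1.inv_inv).pow_left 2
  · exact h0.inv_left.pow_pow 2 2
  · exact h.2.inv_right.pow_left 2
  · exact h1.pow_pow 2 2

theorem lift_braidInner_injective : Function.Injective (FreeGroup.lift (braidInner hn)) := by
  have h : Function.Injective ((burauHom n).comp (FreeGroup.lift (braidInner hn))) := by
    refine FreeGroup.injective_of_sanov _
      (fun v k => if k = 1 then v.1.1 else if k = 2 then v.1.2 else 0) ?_ ?_
    · intro v w hvw
      have h1 := congrFun hvw 1
      have h2 := congrFun hvw 2
      exact Subtype.ext (Prod.ext (by simpa using h1) (by simpa using h2))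
    · intro i v
      fin_cases i
      · simp only [Fin.zero_eta, MonoidHom.comp_apply, FreeGroup.lift_apply_of, braidInner,
          Matrix.cons_val_zero, _root_.map_pow, _root_.map_inv, burauHom_of, Equiv.Perm.smul_def,
          inv_pow]
        rw [Equiv.Perm.inv_eq_iff_eq]
        funext k
        simp only [pow_two, Equiv.Perm.mul_apply, burauPerm_apply, sanovPerm]
        simp
        split_ifs <;> grind
      · simp only [Fin.mk_one, MonoidHom.comp_apply, FreeGroup.lift_apply_of, braidInner,
          Matrix.cons_val_one, Matrix.cons_val_zero, _root_.map_pow, burauHom_of, Equiv.Perm.smul_def]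
        funext k
        simp only [pow_two, Equiv.Perm.mul_apply, burauPerm_apply, sanovPerm]
        simp
        split_ifs <;> grind
  exact Function.Injective.of_comp (f := burauHom n) h

theorem lift_braidOuter_injective : Function.Injective (FreeGroup.lift (braidOuter hn)) := by
  -- The vectors `(p, 0, p, q)` are fixed by the transvections inside the ribbon.
  have h : Function.Injective ((burauHom n).comp (FreeGroup.lift (braidOuter hn))) := by
    refine FreeGroup.injective_of_sanov _
      (fun v k => if k = 1 then v.1.1 else if k = 3 then v.1.1 else if k = 4 then v.1.2 else 0) ?_ ?_
    · intro v w hvw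
      have h1 := congrFun hvw 1
      have h2 := congrFun hvw 4
      exact Subtype.ext (Prod.ext (by simpa using h1) (by simpa using h2))
    · intro i v
      fin_cases i
      · simp only [Fin.zero_eta, MonoidHom.comp_apply, FreeGroup.lift_apply_of, braidOuter,
          Matrix.cons_val_zero, _root_.map_mul, _root_.map_inv, burauHom_of, Equiv.Perm.smul_def]
        rw [Equiv.Perm.inv_eq_iff_eq]
        funext k
        simp only [Equiv.Perm.mul_apply, burauPerm_apply, sanovPerm]
        simp
        split_ifs <;> grind
      · simp only [Fin.mk_one, MonoidHom.comp_apply, FreeGroup.lift_apply_of, braidOuter,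
          Matrix.cons_val_one, Matrix.cons_val_zero, _root_.map_pow, burauHom_of, Equiv.Perm.smul_def]
        funext k
        simp only [pow_two, Equiv.Perm.mul_apply, burauPerm_apply, sanovPerm]
        simp
        split_ifs <;> grind
  exact Function.Injective.of_comp (f := burauHom n) h

end

theorem exists_injective_braidGroup {n : ℕ} (hn : 5 ≤ n) :
    ∃ f : F2F2 →* BraidGroup n, Function.Injective f :=
  ⟨_, MonoidHom.injective_noncommCoprod_of_center
    (fun _ hz => FreeGroup.eq_one_of_forall_commute (x := 0) (y := 1) (by decide) (hz _) (hz _)) _ _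
    (lift_braidInner_injective hn) (lift_braidOuter_injective hn)
    (FreeGroup.commute_lift (commute_braidInner_braidOuter hn))⟩

/-! ### The Hurwitz action -/

section Hurwitz

variable {G : Type*} [Group G]

theorem HurwitzEquiv.refl {g : G} {r : ℕ} (F : Factorization g r) : HurwitzEquiv F F :=
  MulAction.mem_orbit_self F

theorem HurwitzEquiv.symm {g : G} {r : ℕ} {F K : Factorization g r} (h : HurwitzEquiv F K) :
    HurwitzEquiv K F :=
  MulAction.mem_orbit_symm.1 h

theorem HurwitzEquiv.trans {g : G} {r : ℕ} {F K L : Factorization g r} (h : HurwitzEquiv F K)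
    (h' : HurwitzEquiv K L) : HurwitzEquiv F L := by
  rw [HurwitzEquiv, ← MulAction.orbit_eq_iff] at *
  rw [h', h]

theorem smul_of_eq_hurwitzPerm {g : G} {r : ℕ} (i : Fin (r - 1)) (F : Factorization g r) :
    F <• (PresentedGroup.of i : BraidGroup r) = hurwitzPerm g i F :=
  Subtype.ext (hurwitzAction_of g i F)

theorem hurwitzEquiv_hurwitzPerm {g : G} {r : ℕ} (i : Fin (r - 1)) (F : Factorization g r) :
    HurwitzEquiv F (hurwitzPerm g i F) :=
  ⟨_, smul_of_eq_hurwitzPerm i F⟩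

theorem hurwitzEquiv_hurwitzPerm_symm {g : G} {r : ℕ} (i : Fin (r - 1)) (F : Factorization g r) :
    HurwitzEquiv F ((hurwitzPerm g i).symm F) := by
  have h := hurwitzEquiv_hurwitzPerm i ((hurwitzPerm g i).symm F)
  rw [Equiv.apply_symm_apply] at h
  exact h.symm

theorem HurwitzEquiv.induction {g : G} {r : ℕ} {Q : Factorization g r → Prop}
    (hpos : ∀ i K, Q K → Q (hurwitzPerm g i K))
    (hneg : ∀ i K, Q K → Q ((hurwitzPerm g i).symm K))
    {F K : Factorization g r} (h : HurwitzEquiv F K) (hF : Q F) : Q K := by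
  have key : ∀ (w : FreeGroup (Fin (r - 1))) (K : Factorization g r), Q K →
      Q (K <• (PresentedGroup.mk (braidRels r) w)) := by
    intro w
    induction w using FreeGroup.induction_on with
    | C1 => intro K hK; rwa [map_one, MulOpposite.op_one, one_smul]
    | of i =>
      intro K hK
      change Q (K <• (PresentedGroup.of i : BraidGroup r))
      rw [smul_of_eq_hurwitzPerm]
      exact hpos i K hK
    | inv_of i _ =>
      intro K hK
      have h : K <• (PresentedGroup.of i : BraidGroup r)⁻¹ = (hurwitzPerm g i).symm K := by
        rw [MulOpposite.op_inv, inv_smul_eq_iff, smul_of_eq_hurwitzPerm, Equiv.apply_symm_apply]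
      rw [map_inv]
      change Q (K <• (PresentedGroup.of i : BraidGroup r)⁻¹)
      rw [h]
      exact hneg i K hK
    | mul a b ha hb =>
      intro K hK
      rw [map_mul, MulOpposite.op_mul, mul_smul]
      exact hb _ (ha _ hK)
  obtain ⟨b, rfl⟩ := h
  obtain ⟨w, hw⟩ := PresentedGroup.mk_surjective _ b.unop
  have := key w F hF
  rw [hw] at this
  exact this

section Map

variable {G' : Type*} [Group G'] (f : G →* G') {r : ℕ}

theorem Factorization.map_hurwitzPerm (i : Fin (r - 1)) (F : Factorization (1 : G) r) :
    (hurwitzPerm 1 i F).map f = hurwitzPerm 1 i (F.map f) := by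
  have h : ∀ (E : Fin r → G) k, f (hurwitzMove i E k) = hurwitzMove i (fun k => f (E k)) k := by
    intro E k
    simp only [hurwitzMove]
    split_ifs <;> simp
  exact Subtype.ext (funext (h F.1))

theorem Factorization.map_hurwitzPerm_symm (i : Fin (r - 1)) (F : Factorization (1 : G) r) :
    ((hurwitzPerm 1 i).symm F).map f = (hurwitzPerm 1 i).symm (F.map f) := by
  rw [Equiv.eq_symm_apply, ← Factorization.map_hurwitzPerm, Equiv.apply_symm_apply]

theorem hurwitzEquiv_map_iff (hf : Function.Injective f) {F K : Factorization (1 : G) r} :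
    HurwitzEquiv (F.map f) (K.map f) ↔ HurwitzEquiv F K := by
  constructor
  · intro h
    obtain ⟨K', hK', h'⟩ := h.induction (Q := fun L => ∃ K' : Factorization (1 : G) r,
        L = K'.map f ∧ HurwitzEquiv F K')
      (by
        rintro i _ ⟨K', rfl, h⟩
        exact ⟨_, (Factorization.map_hurwitzPerm f i K').symm,
          h.trans (hurwitzEquiv_hurwitzPerm i K')⟩)
      (by
        rintro i _ ⟨K', rfl, h⟩
        exact ⟨_, (Factorization.map_hurwitzPerm_symm f i K').symm,
          h.trans (hurwitzEquiv_hurwitzPerm_symm i K')⟩)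
      ⟨F, rfl, .refl F⟩
    have : K = K' := Subtype.ext (funext fun k => hf (congrFun (congrArg Subtype.val hK') k))
    rwa [this]
  · intro h
    refine h.induction (Q := fun K => HurwitzEquiv (F.map f) (K.map f)) ?_ ?_ (.refl _)
    · intro i K h
      rw [Factorization.map_hurwitzPerm]
      exact h.trans (hurwitzEquiv_hurwitzPerm _ _)
    · intro i K h
      rw [Factorization.map_hurwitzPerm_symm]
      exact h.trans (hurwitzEquiv_hurwitzPerm_symm _ _)

end Map

theorem HurwitzEquiv.exists_conj {g : G} {r : ℕ} {F K : Factorization g r} (h : HurwitzEquiv F K)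
    (k : Fin r) :
    ∃ j, ∃ x ∈ Subgroup.closure (Set.range F.1), K.1 k = x⁻¹ * F.1 j * x := by
  set S := Subgroup.closure (Set.range F.1)
  refine h.induction
    (Q := fun K => ∀ k, ∃ j, ∃ x ∈ S, K.1 k = x⁻¹ * F.1 j * x) ?_ ?_
    (fun k => ⟨k, 1, S.one_mem, by simp⟩) k
  all_goals
    intro i K hK k
    have hmem : ∀ k, K.1 k ∈ S := fun k => by
      obtain ⟨j, x, hx, hk⟩ := hK k
      rw [hk]
      exact S.mul_mem (S.mul_mem (S.inv_mem hx) (Subgroup.subset_closure ⟨j, rfl⟩)) hx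
  · rw [hurwitzPerm_apply, hurwitzMove]
    split_ifs
    · exact hK _
    · obtain ⟨j, x, hx, hk⟩ := hK ⟨i, by omega⟩
      exact ⟨j, x * K.1 ⟨i + 1, by omega⟩, S.mul_mem hx (hmem _), by simp [hk, mul_assoc]⟩
    · exact hK _
  · change ∃ j, ∃ x ∈ S, hurwitzMoveInv i K.1 k = _
    rw [hurwitzMoveInv]
    split_ifs
    · obtain ⟨j, x, hx, hk⟩ := hK ⟨i + 1, by omega⟩
      exact ⟨j, x * (K.1 ⟨i, by omega⟩)⁻¹, S.mul_mem hx (S.inv_mem (hmem _)),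
        by simp [hk, mul_assoc]⟩
    · exact hK _
    · exact hK _

/-! ### Hurwitz moves on lists -/

/-- The Hurwitz move `(…, x, y, …) ↦ (…, y, y⁻¹ x y, …)` on the list of entries. Lists make it easy
to move a block of entries along a factorization. -/
def HurwitzStep (L L' : List G) : Prop :=
  ∃ A x y B, L = A ++ x :: y :: B ∧ L' = A ++ y :: (y⁻¹ * x * y) :: B

theorem HurwitzStep.exists_hurwitzEquiv {L L' : List G} (h : HurwitzStep L L') {g : G} {r : ℕ}
    (F : Factorization g r) (hF : List.ofFn F.1 = L) :
    ∃ K : Factorization g r, List.ofFn K.1 = L' ∧ HurwitzEquiv F K := by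
  obtain ⟨A, x, y, B, rfl, rfl⟩ := h
  have hr : r = A.length + B.length + 2 := by
    have := congrArg List.length hF
    simp at this
    omega
  have hk : ∀ k (hk : k < r), F.1 ⟨k, hk⟩ = (A ++ x :: y :: B)[k]'(by simp; omega) := by
    intro k hk
    simp [← hF]
  refine ⟨_, ?_, hurwitzEquiv_hurwitzPerm ⟨A.length, by omega⟩ F⟩
  rw [hurwitzPerm_apply]
  apply List.ext_getElem
  · simp; omega
  · intro k h1 h2
    rw [List.getElem_ofFn]
    simp only [hurwitzMove, hk]
    grind

theorem HurwitzStep.exists_hurwitzEquiv_symm {L L' : List G} (h : HurwitzStep L L') {g : G} {r : ℕ}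
    (F : Factorization g r) (hF : List.ofFn F.1 = L') :
    ∃ K : Factorization g r, List.ofFn K.1 = L ∧ HurwitzEquiv F K := by
  obtain ⟨A, x, y, B, rfl, rfl⟩ := h
  have hr : r = A.length + B.length + 2 := by
    have := congrArg List.length hF
    simp at this
    omega
  have hk : ∀ k (hk : k < r),
      F.1 ⟨k, hk⟩ = (A ++ y :: (y⁻¹ * x * y) :: B)[k]'(by simp; omega) := by
    intro k hk
    simp [← hF]
  refine ⟨_, ?_, hurwitzEquiv_hurwitzPerm_symm ⟨A.length, by omega⟩ F⟩
  change List.ofFn (hurwitzMoveInv _ F.1) = _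
  apply List.ext_getElem
  · simp; omega
  · intro k h1 h2
    rw [List.getElem_ofFn]
    simp only [hurwitzMoveInv, hk]
    have : y * (y⁻¹ * x * y) * y⁻¹ = x := by group
    grind

theorem exists_hurwitzEquiv_of_eqvGen {L L' : List G} (h : Relation.EqvGen HurwitzStep L L') {g : G}
    {r : ℕ} :
    (∀ F : Factorization g r, List.ofFn F.1 = L →
      ∃ K : Factorization g r, List.ofFn K.1 = L' ∧ HurwitzEquiv F K) ∧
    ∀ F : Factorization g r, List.ofFn F.1 = L' →
      ∃ K : Factorization g r, List.ofFn K.1 = L ∧ HurwitzEquiv F K := by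
  induction h with
  | rel L L' h => exact ⟨h.exists_hurwitzEquiv, h.exists_hurwitzEquiv_symm⟩
  | refl L => exact ⟨fun F hF => ⟨F, hF, .refl F⟩, fun F hF => ⟨F, hF, .refl F⟩⟩
  | symm L L' _ ih => exact ih.symm
  | trans L L' L'' _ _ ih ih' =>
    constructor
    · intro F hF
      obtain ⟨K, hK, h⟩ := ih.1 F hF
      obtain ⟨K', hK', h'⟩ := ih'.1 K hK
      exact ⟨K', hK', h.trans h'⟩
    · intro F hF
      obtain ⟨K, hK, h⟩ := ih'.2 F hF
      obtain ⟨K', hK', h'⟩ := ih.2 K hK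
      exact ⟨K', hK', h.trans h'⟩

theorem hurwitzEquiv_of_eqvGen {g : G} {r : ℕ} {F K : Factorization g r}
    (h : Relation.EqvGen HurwitzStep (List.ofFn F.1) (List.ofFn K.1)) : HurwitzEquiv F K := by
  obtain ⟨K', hK', h'⟩ := (exists_hurwitzEquiv_of_eqvGen h).1 F rfl
  rwa [Subtype.ext (List.ofFn_injective hK')] at h'

/-- A pair with trivial product moves past an entry, and leaves it unchanged. -/
theorem eqvGen_pair_swap (A B : List G) (f c : G) :
    Relation.EqvGen HurwitzStep (A ++ f :: c⁻¹ :: c :: B) (A ++ c⁻¹ :: c :: f :: B) := by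
  refine .trans _ (A ++ c⁻¹ :: (c * f * c⁻¹) :: c :: B) _ (.rel _ _ ?_) (.rel _ _ ?_)
  · exact ⟨A, f, c⁻¹, c :: B, rfl, by simp⟩
  · exact ⟨A ++ [c⁻¹], c * f * c⁻¹, c, B, by simp, by simp [mul_assoc]⟩

theorem eqvGen_pair_conj (A B : List G) (f c : G) :
    Relation.EqvGen HurwitzStep (A ++ c⁻¹ :: c :: f :: B)
      (A ++ f :: (f⁻¹ * c * f)⁻¹ :: (f⁻¹ * c * f) :: B) := by
  refine .trans _ (A ++ c⁻¹ :: f :: (f⁻¹ * c * f) :: B) _ (.rel _ _ ?_) (.rel _ _ ?_)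
  · exact ⟨A ++ [c⁻¹], c, f, B, by simp, by simp⟩
  · exact ⟨A, c⁻¹, f, (f⁻¹ * c * f) :: B, rfl, by simp [mul_assoc]⟩

theorem eqvGen_pair_move (A L B : List G) (c : G) :
    Relation.EqvGen HurwitzStep (A ++ (L ++ c⁻¹ :: c :: B)) (A ++ c⁻¹ :: c :: (L ++ B)) := by
  induction L generalizing A with
  | nil => exact .refl _
  | cons f L ih =>
    have h := ih (A ++ [f])
    simp only [List.append_assoc, List.cons_append, List.nil_append] at h ⊢
    exact h.trans _ _ _ (eqvGen_pair_swap A (L ++ B) f c)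

theorem eqvGen_pair_conj_of_mem {L : List G} {f : G} (hf : f ∈ L) (c : G) :
    Relation.EqvGen HurwitzStep (L ++ [c⁻¹, c]) (L ++ [(f⁻¹ * c * f)⁻¹, f⁻¹ * c * f]) := by
  obtain ⟨A, B, rfl⟩ := List.append_of_mem hf
  have h1 := eqvGen_pair_move A (f :: B) [] c
  have h2 := eqvGen_pair_conj A B f c
  have h3 := eqvGen_pair_move (A ++ [f]) B [] (f⁻¹ * c * f)
  simp only [List.append_assoc, List.cons_append, List.nil_append, List.append_nil] at h1 h3 ⊢
  exact (h1.trans _ _ _ h2).trans _ _ _ h3.symm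

/-- A pair with trivial product at the end of a list is conjugated by any element of the subgroup
that the other entries generate, while these stay as they are. -/
theorem eqvGen_pair_conj_of_mem_closure {L : List G} {x : G}
    (hx : x ∈ Subgroup.closure {f | f ∈ L}) (c : G) :
    Relation.EqvGen HurwitzStep (L ++ [c⁻¹, c]) (L ++ [(x⁻¹ * c * x)⁻¹, x⁻¹ * c * x]) := by
  induction hx using Subgroup.closure_induction generalizing c with
  | mem f hf => exact eqvGen_pair_conj_of_mem hf c
  | one => simpa using Relation.EqvGen.refl _
  | mul x y _ _ hx hy =>
    have := (hx c).trans _ _ _ (hy _)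
    simpa only [mul_inv_rev, mul_assoc] using this
  | inv x _ hx =>
    have := (hx (x * c * x⁻¹)).symm
    simpa [mul_assoc] using this

end Hurwitz

/-! ### Factorizations encoding a word -/

section Encoding

theorem map_closeUp {G G' : Type*} [Group G] [Group G'] (f : G →* G') {k : ℕ} (g : Fin k → G)
    (j : Fin (k + 1)) : f (closeUp g j) = closeUp (fun i => f (g i)) j := by
  induction j using Fin.lastCases with
  | last => simp [closeUp, map_list_prod, List.map_ofFn, Function.comp_def]
  | cast j => simp [closeUp]

theorem closeUp_one {G : Type*} [Group G] {k : ℕ} (j : Fin (k + 1)) :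
    closeUp (fun _ : Fin k => (1 : G)) j = 1 := by
  induction j using Fin.lastCases with
  | last => simp [closeUp]
  | cast j => simp [closeUp]

variable {n m : ℕ} (V : Fin m → GWord n)

/-- The entries of `FTLP V a` that do not depend on `a`. -/
def FTLP.common : List (FreeGroup (Fin n) × FreeGroup (Fin (n + 1))) :=
  List.ofFn (fun j => (closeUp (evalWords V) j, (1 : FreeGroup (Fin (n + 1))))) ++
    List.ofFn (fun j => (closeUp (fun i : Fin n => FreeGroup.of i) j,
      closeUp (fun i : Fin n => FreeGroup.of i.castSucc) j))

/-- The last entry of `FTLP V a`. The one before it is the inverse. -/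
def FTLP.last (a : GWord n) : FreeGroup (Fin n) × FreeGroup (Fin (n + 1)) :=
  (FreeGroup.mk a, FreeGroup.of (Fin.last n))

theorem ofFn_FTLP (a : GWord n) :
    List.ofFn (FTLP V a).1 = FTLP.common V ++ [(FTLP.last a)⁻¹, FTLP.last a] := by
  have h : (fun j => (Fin.append (closeUp fun i : Fin n => FreeGroup.of i)
        ![(FreeGroup.mk a)⁻¹, FreeGroup.mk a] j, FTLX n j)) =
      Fin.append (fun j => (closeUp (fun i : Fin n => FreeGroup.of i) j,
        closeUp (fun i : Fin n => FreeGroup.of i.castSucc) j))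
        ![(FTLP.last a)⁻¹, FTLP.last a] := by
    funext j
    induction j using Fin.addCases with
    | left j => simp [FTLX]
    | right j => fin_cases j <;> simp [FTLX, FTLP.last]
  change List.ofFn (PX (FTLX n) (closeUp (evalWords V)) (closeUp fun i : Fin n => FreeGroup.of i)
    (FreeGroup.mk a)) = _
  rw [PX, h, List.ofFn_fin_append, List.ofFn_fin_append, FTLP.common, List.append_assoc]
  simp

/-- Conjugation of `v_j` in the first factor by a word in the `z_i` is effected by the same word in
the entries `(z_i, X_i)`. -/
theorem mem_closure_common {x : FreeGroup (Fin n)}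
    (hx : x ∈ Subgroup.normalClosure (Set.range (evalWords V))) :
    (x, 1) ∈ Subgroup.closure {f | f ∈ FTLP.common V} := by
  set S := Subgroup.closure {f | f ∈ FTLP.common V} with hS
  have hz : ∀ y : FreeGroup (Fin n), (y, FreeGroup.map Fin.castSucc y) ∈ S := by
    intro y
    induction y using FreeGroup.induction_on with
    | C1 => rw [_root_.map_one]; exact S.one_mem
    | of i =>
      refine Subgroup.subset_closure (List.mem_append_right _ (List.mem_ofFn.2 ⟨i.castSucc, ?_⟩))
      simp [closeUp]
    | inv_of i h => rw [_root_.map_inv]; exact S.inv_mem h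
    | mul a b ha hb => rw [_root_.map_mul]; exact S.mul_mem ha hb
  have hnormal : (S.comap (MonoidHom.inl (FreeGroup (Fin n)) (FreeGroup (Fin (n + 1))))).Normal := by
    refine ⟨fun y hy x => ?_⟩
    rw [Subgroup.mem_comap, MonoidHom.inl_apply] at hy ⊢
    simpa using S.mul_mem (S.mul_mem (hz x) hy) (S.inv_mem (hz x))
  refine Subgroup.normalClosure_le_normal (N := S.comap (MonoidHom.inl _ _)) ?_ hx
  rintro _ ⟨j, rfl⟩
  refine Subgroup.subset_closure (List.mem_append_left _ (List.mem_ofFn.2 ⟨j.castSucc, ?_⟩))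
  simp [closeUp]

theorem hurwitzEquiv_FTLP_of_conj {a b : GWord n} {x : FreeGroup (Fin n)}
    (hx : x ∈ Subgroup.normalClosure (Set.range (evalWords V)))
    (h : FreeGroup.mk b = x⁻¹ * FreeGroup.mk a * x) : HurwitzEquiv (FTLP V a) (FTLP V b) := by
  apply hurwitzEquiv_of_eqvGen
  rw [ofFn_FTLP, ofFn_FTLP]
  have hlast : FTLP.last b = (x, 1)⁻¹ * FTLP.last a * (x, 1) := by
    simp [FTLP.last, h]
  rw [hlast]
  exact eqvGen_pair_conj_of_mem_closure (mem_closure_common V hx) _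

/-- The homomorphism of the second factor to the presented group that sends `X_i` to `z_i` and the
last generator to `1`. On the group generated by the entries it agrees with the quotient map of the
first factor. -/
def FTLP.collapse : FreeGroup (Fin (n + 1)) →* PresentedGroup (Set.range (evalWords V)) :=
  FreeGroup.lift (Fin.snoc (fun i => PresentedGroup.of i) 1)

theorem collapse_eq_of_mem_closure {a : GWord n}
    (ha : FreeGroup.mk a ∈ Subgroup.normalClosure (Set.range (evalWords V)))
    {x : FreeGroup (Fin n) × FreeGroup (Fin (n + 1))}
    (hx : x ∈ Subgroup.closure (Set.range (FTLP V a).1)) :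
    PresentedGroup.mk _ x.1 = FTLP.collapse V x.2 := by
  suffices h : Subgroup.closure (Set.range (FTLP V a).1) ≤
      ((PresentedGroup.mk _).comp (MonoidHom.fst _ _)).eqLocus
        ((FTLP.collapse V).comp (MonoidHom.snd _ _)) from h hx
  rw [Subgroup.closure_le]
  rintro _ ⟨j, rfl⟩
  have hf : (FTLP V a).1 j ∈ List.ofFn (FTLP V a).1 := List.mem_ofFn.2 ⟨j, rfl⟩
  rw [ofFn_FTLP] at hf
  generalize (FTLP V a).1 j = f at hf
  have hlast : PresentedGroup.mk _ (FTLP.last a).1 = FTLP.collapse V (FTLP.last a).2 := by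
    simpa [FTLP.last, FTLP.collapse] using PresentedGroup.mk_eq_one_iff.2 ha
  change PresentedGroup.mk _ f.1 = FTLP.collapse V f.2
  simp only [FTLP.common, List.mem_append, List.mem_ofFn, List.mem_cons, List.not_mem_nil,
    or_false] at hf
  rcases hf with (⟨j, rfl⟩ | ⟨j, rfl⟩) | rfl | rfl
  · rw [map_closeUp, _root_.map_one, ← closeUp_one j]
    congr
    funext i
    exact PresentedGroup.one_of_mem ⟨i, rfl⟩
  · rw [map_closeUp, map_closeUp]
    congr
    funext i
    simp [FTLP.collapse, PresentedGroup.of]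
  · rw [Prod.fst_inv, Prod.snd_inv, _root_.map_inv, _root_.map_inv, hlast]
  · exact hlast

/-- The last entry is the only one whose second coordinate has exponent sum `1` in the last
generator. -/
theorem eq_last_of_exponentSum {a : GWord n} {j : Fin (m + 1 + (n + 1 + 2))}
    (h : FreeGroup.exponentSum (Fin.last n) ((FTLP V a).1 j).2 = Multiplicative.ofAdd 1) :
    (FTLP V a).1 j = FTLP.last a := by
  have hmem : (FTLP V a).1 j ∈ List.ofFn (FTLP V a).1 := List.mem_ofFn.2 ⟨j, rfl⟩
  rw [ofFn_FTLP] at hmem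
  generalize (FTLP V a).1 j = f at h hmem
  simp only [FTLP.common, List.mem_append, List.mem_ofFn, List.mem_cons, List.not_mem_nil,
    or_false] at hmem
  rcases hmem with (⟨j, rfl⟩ | ⟨j, rfl⟩) | rfl | rfl
  · rw [_root_.map_one] at h
    exact absurd h (by decide)
  · have h0 : ∀ i : Fin n, FreeGroup.exponentSum (Fin.last n) (FreeGroup.of i.castSucc) = 1 :=
      fun i => FreeGroup.exponentSum_of_ne (Fin.castSucc_lt_last i).ne
    simp only [map_closeUp, h0, closeUp_one] at h
    exact absurd h (by decide)
  · simp only [FTLP.last, Prod.snd_inv, _root_.map_inv, FreeGroup.exponentSum_of_self] at h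
    exact absurd h (by decide)
  · rfl

theorem exists_conj_of_hurwitzEquiv_FTLP {a b : GWord n}
    (ha : FreeGroup.mk a ∈ Subgroup.normalClosure (Set.range (evalWords V)))
    (h : HurwitzEquiv (FTLP V a) (FTLP V b)) :
    ∃ x ∈ Subgroup.normalClosure (Set.range (evalWords V)),
      FreeGroup.mk b = x⁻¹ * FreeGroup.mk a * x := by
  obtain ⟨k, hk⟩ : ∃ k, (FTLP V b).1 k = FTLP.last b := by
    rw [← List.mem_ofFn, ofFn_FTLP]
    simp
  obtain ⟨j, x, hx, hj⟩ := h.exists_conj k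
  rw [hk] at hj
  have hjlast : (FTLP V a).1 j = FTLP.last a := by
    apply eq_last_of_exponentSum
    have := congrArg (fun f => FreeGroup.exponentSum (Fin.last n) f.2) hj
    simp only [FTLP.last, FreeGroup.exponentSum_of_self, Prod.snd_mul, Prod.snd_inv,
      _root_.map_mul, _root_.map_inv] at this
    rw [this, mul_comm, mul_inv_cancel_left]
  rw [hjlast] at hj
  have h1 : FreeGroup.mk b = x.1⁻¹ * FreeGroup.mk a * x.1 := congrArg Prod.fst hj
  have h2 : FreeGroup.of (Fin.last n) = x.2⁻¹ * FreeGroup.of (Fin.last n) * x.2 :=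
    congrArg Prod.snd hj
  refine ⟨x.1, ?_, h1⟩
  -- `x.2` centralizes the last generator, so it is a power of it and collapses to `1`.
  have hcomm : Commute (FreeGroup.of (Fin.last n)) x.2 := by
    rw [mul_assoc, eq_inv_mul_iff_mul_eq] at h2
    exact h2.symm
  obtain ⟨s, hs⟩ := hcomm.mem_zpowers_of_not_hasRoot (FreeGroup.not_hasRoot_of _)
  rw [← PresentedGroup.mk_eq_one_iff, collapse_eq_of_mem_closure V ha hx, ← hs]
  simp [FTLP.collapse]

end Encoding

theorem nonempty_FTLChoices : Nonempty FTLChoices := by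
  have hroot : ∀ {n m : ℕ} (V : Fin m → GWord n), ∃ H : GWord n,
      2 ≤ n → (∃ j, evalWords V j ≠ 1) →
        FreeGroup.mk H ∈ Subgroup.normalClosure (Set.range (evalWords V)) ∧
          ¬ HasRoot (FreeGroup.mk H) := by
    intro n m V
    by_cases h : 2 ≤ n ∧ ∃ j, evalWords V j ≠ 1
    · obtain ⟨hn, j, hj⟩ := h
      obtain ⟨g, hg, hr⟩ := exists_mem_not_hasRoot hn
        (Subgroup.normalClosure (Set.range (evalWords V)))
        (Subgroup.subset_normalClosure ⟨j, rfl⟩) hj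
      exact ⟨g.toWord, fun _ _ => by rw [FreeGroup.mk_toWord]; exact ⟨hg, hr⟩⟩
    · exact ⟨[], fun h1 h2 => absurd ⟨h1, h2⟩ h⟩
  choose H hH using @hroot
  choose f hf using @exists_injective_braidGroup
  exact ⟨{
    inj := fun r₁ r₂ => (FreeGroup.toRankTwo r₁).prodMap (FreeGroup.toRankTwo r₂)
    inj_injective := fun r₁ r₂ =>
      (FreeGroup.toRankTwo_injective r₁).prodMap (FreeGroup.toRankTwo_injective r₂)
    rootless := H
    rootless_mem := fun V hn hV => (hH V hn hV).1
    rootless_not_hasRoot := fun V hn hV => (hH V hn hV).2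
    braidInj := fun _ hn => f hn
    braidInj_injective := fun _ hn => hf hn }⟩

theorem mainTheorem3 :
    Nonempty FTLChoices ∧
    ∀ (c : FTLChoices) (n : ℕ) (hn : 5 ≤ n) (G : GSPresentation) (a b : GWord G.numGens),
      G.eval a = G.eval b ↔ HurwitzEquiv (FTLn c n hn G a) (FTLn c n hn G b) := by
  refine ⟨nonempty_FTLChoices, fun c n hn G a b => ?_⟩
  rw [FTLn, FTLn, hurwitzEquiv_map_iff _ (c.braidInj_injective n hn), FTLB, FTLB, FTLs2, FTLs2,
    FTLs1, FTLs1, hurwitzEquiv_map_iff _ (c.inj_injective _ _)]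
  set N := Subgroup.normalClosure (Set.range (evalWords G.rel)) with hN
  set H : FreeGroup (Fin G.numGens) := FreeGroup.mk (c.rootless G.rel) with hH
  have hmem : H ∈ N := c.rootless_mem G.rel G.two_le_numGens G.exists_rel_ne_one
  have hroot : ¬ HasRoot H := c.rootless_not_hasRoot G.rel G.two_le_numGens G.exists_rel_ne_one
  have hword : ∀ w : GWord G.numGens,
      FreeGroup.mk (FreeGroup.invRev w ++ c.rootless G.rel ++ w) =
        (FreeGroup.mk w)⁻¹ * H * FreeGroup.mk w := by
    intro w
    rw [FreeGroup.inv_mk, hH, FreeGroup.mul_mk, FreeGroup.mul_mk]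
  have heval : G.eval a = G.eval b ↔ (FreeGroup.mk a)⁻¹ * FreeGroup.mk b ∈ N :=
    QuotientGroup.eq
  rw [heval]
  constructor
  · intro h
    refine hurwitzEquiv_FTLP_of_conj G.rel h ?_
    rw [hword, hword]
    group
  · intro h
    obtain ⟨x, hx, hconj⟩ := exists_conj_of_hurwitzEquiv_FTLP G.rel
      (by
        rw [hword]
        simpa using Subgroup.normalClosure_normal.conj_mem H hmem (FreeGroup.mk a)⁻¹) h
    rw [hword, hword] at hconj
    -- `a x b⁻¹` centralizes the rootless `H`, so it is a power of `H`.
    have hcomm : Commute H (FreeGroup.mk a * x * (FreeGroup.mk b)⁻¹) := by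
      have h1 : H = FreeGroup.mk b * ((FreeGroup.mk b)⁻¹ * H * FreeGroup.mk b) *
        (FreeGroup.mk b)⁻¹ := by group
      rw [hconj] at h1
      calc H * (FreeGroup.mk a * x * (FreeGroup.mk b)⁻¹)
          = FreeGroup.mk a * x * (FreeGroup.mk b)⁻¹ * (FreeGroup.mk b *
              (x⁻¹ * ((FreeGroup.mk a)⁻¹ * H * FreeGroup.mk a) * x) * (FreeGroup.mk b)⁻¹) := by group
        _ = FreeGroup.mk a * x * (FreeGroup.mk b)⁻¹ * H := by rw [← h1]
    have hpow : FreeGroup.mk a * x * (FreeGroup.mk b)⁻¹ ∈ N :=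
      (Subgroup.zpowers_le.2 hmem) (hcomm.mem_zpowers_of_not_hasRoot hroot)
    have hb := Subgroup.normalClosure_normal.conj_mem _ (N.inv_mem hpow) (FreeGroup.mk a)⁻¹
    have heq : (FreeGroup.mk a)⁻¹ * FreeGroup.mk b = (FreeGroup.mk a)⁻¹ *
        (FreeGroup.mk a * x * (FreeGroup.mk b)⁻¹)⁻¹ * (FreeGroup.mk a)⁻¹⁻¹ * x := by
      group
    rw [heq]
    exact N.mul_mem hb hx
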